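/- Let $\mathcal P=\{1,\dots,n\}$ be a set of ports, with finite input alphabets $I_p$ and finite output alphabets $O_p$ $(p\in\mathcal P)$; symbols are labelled by their port, so that alphabets of different ports are disjoint. Put $Act_p=I_p\cup O_p$, $I=\bigcup_p I_p$, and $O=\prod_p (O_p\cup\{-\})$, where $-$ is null output. A (multi-port, possibly nondeterministic) FSM over these alphabets consists of a finite set of states $S$, an initial state $s_0\in S$ and a transition relation $h\subseteq (S\times I)\times(S\times O)$; it need not be completely specified or initially connected. $L(M)$ is the set of labels $x_1/y_1\cdots x_k/y_k$ $(k\ge 0)$ of paths of $M$ that start in the initial state. For a global trace $\sigma$, its projection $\pi_p(\sigma)\in Act_p^*$ is obtained by replacing each $x/(z_1,\dots,z_n)$ by $x$ if $x\in I_p$ (and by nothing otherwise), followed by $z_p$ if $z_p\ne -$. Write $\sigma\sim\sigma'$ if $\pi_p(\sigma)=\pi_p(\sigma')$ for all $p$, and $N\sqsubseteq_s M$ if for every $\sigma\in L(N)$ there is $\sigma'\in L(M)$ with $\sigma'\sim\sigma$. The Parikh image of a global trace, read as a sequence over $\bigcup_p Act_p$ (each input followed by the non-null outputs it triggers), is the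 vector in $\mathbb N^{\bigcup_p Act_p}$ counting the occurrences of each symbol; the Parikh image of a set of traces is the set of Parikh images of its elements. Proposition. (1) Let $N$ and $M$ be FSMs with the same ports and the same alphabets, and suppose that $|Act_p|\le 1$ for every port $p$. Then the Parikh images of $L(N)$ and $L(M)$ are semilinear sets, and $N\sqsubseteq_s M$ if and only if the Parikh image of $L(N)$ is contained in the Parikh image of $L(M)$. (2) It is decidable, given such alphabets and such $N$ and $M$ (as finite descriptions listing the alphabets, the number of states, the initial state and the transitions), whether $N\sqsubseteq_s M$: there is one total computable Boolean function that gives the correct answer on every description of such a triple. -/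

import Mathlib

namespace MultiPort

/-- Finite input and output alphabets `I p`, `O p` at each of the ports `p : Fin n`. An observation
is always tagged with the port where it occurs, so alphabets of different ports are disjoint even
if they use the same symbol of `A`. -/
structure Interface (n : ℕ) (A : Type*) where
  I : Fin n → Finset A
  O : Fin n → Finset A

namespace Interface

variable {n : ℕ} {A : Type*} (Γ : Interface n A)

/-- The inputs: a port `p` together with an element of `I p`. -/
abbrev Input := Σ p : Fin n, {x : A // x ∈ Γ.I p}

/-- The outputs `(z_1, …, z_n)`: for each port `p` an element of `O p`, or `none` (null output). -/
abbrev Output := ∀ p : Fin n, Option {z : A // z ∈ Γ.O p}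

/-- Global traces `x_1/y_1 … x_k/y_k`. -/
abbrev Trace := List (Γ.Input × Γ.Output)

variable [DecidableEq A]

/-- The set of possible observations at port `p`. -/
def Act (p : Fin n) : Finset A := Γ.I p ∪ Γ.O p

/-- The observations at port `p`, as a type. -/
abbrev Obs (p : Fin n) := {a : A // a ∈ Γ.Act p}

/-- All observations, at all ports. -/
abbrev Letter := Σ p : Fin n, Γ.Obs p

/-- The observation of an input at `p`. -/
def obsIn {p : Fin n} (x : {x : A // x ∈ Γ.I p}) : Γ.Obs p :=
  ⟨x.1, Finset.mem_union_left _ x.2⟩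

/-- The observation of a non-null output at `p`. -/
def obsOut {p : Fin n} (z : {z : A // z ∈ Γ.O p}) : Γ.Obs p :=
  ⟨z.1, Finset.mem_union_right _ z.2⟩

/-- The projection of a global trace at port `p`. -/
def proj (p : Fin n) : Γ.Trace → List (Γ.Obs p)
  | [] => []
  | (⟨q, x⟩, y) :: σ =>
      (if h : q = p then [Γ.obsIn (h ▸ x)] else []) ++ ((y p).map Γ.obsOut).toList ++ proj p σ

/-- Indistinguishability `σ ∼ σ'`: the same projection at every port. -/
def Indist (σ σ' : Γ.Trace) : Prop := ∀ p, Γ.proj p σ = Γ.proj p σ'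

/-- A global trace written as a sequence of observations: each input is followed by the non-null
outputs that it triggers, in the order of the ports. -/
def word : Γ.Trace → List Γ.Letter
  | [] => []
  | (⟨q, x⟩, y) :: σ =>
      ⟨q, Γ.obsIn x⟩ ::
        ((List.finRange n).flatMap fun p => ((y p).map fun z => ⟨p, Γ.obsOut z⟩).toList) ++ word σ

/-- The Parikh image of a sequence of observations: the number of occurrences of each. -/
def parikh (w : List Γ.Letter) : Γ.Letter → ℕ := fun a => w.count a

/-- The Parikh image of a set of global traces, read as sequences of observations. -/
def parikhImage (L : Set Γ.Trace) : Set (Γ.Letter → ℕ) := {v | ∃ σ ∈ L, v = Γ.parikh (Γ.word σ)}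

end Interface

/-- A (possibly nondeterministic) finite state machine with the given ports and alphabets. -/
structure FSM {n : ℕ} {A : Type*} (Γ : Interface n A) where
  S : Type*
  finite : Finite S
  init : S
  h : S → Γ.Input → Set (S × Γ.Output)

namespace FSM

variable {n : ℕ} {A : Type*} {Γ : Interface n A}

/-- `M.Path s σ s'`: there is a path of `M` from `s` to `s'` with label `σ`. -/
inductive Path (M : FSM Γ) : M.S → Γ.Trace → M.S → Prop
  | nil (s : M.S) : Path M s [] s
  | cons {s s' s'' : M.S} {x : Γ.Input} {y : Γ.Output} {σ : Γ.Trace} :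
      (s', y) ∈ M.h s x → Path M s' σ s'' → Path M s ((x, y) :: σ) s''

/-- The language `L(M)`: labels of the paths that start in the initial state. -/
def lang (M : FSM Γ) : Set Γ.Trace := {σ | ∃ s, M.Path M.init σ s}

/-- Strong conformance `N ⊑_s M`. -/
def StronglyConforms [DecidableEq A] (N M : FSM Γ) : Prop :=
  ∀ σ ∈ N.lang, ∃ σ' ∈ M.lang, Γ.Indist σ' σ

end FSM

/-- Finite descriptions of alphabets: for each port, in order, the list of (numerical names of) its
inputs and the list of its outputs. -/
abbrev InterfaceCode := List (List ℕ × List ℕ)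

/-- Finite descriptions of transitions: `((s, p, x), (s', [z_1, …, z_n]))` stands for the
transition from state `s` to state `s'` on input `x` at port `p` with output `(z_1, …, z_n)`. -/
abbrev TransitionCode := (ℕ × ℕ × ℕ) × (ℕ × List (Option ℕ))

/-- Finite descriptions of FSMs: the number of states, the number of the initial state, and the list
of transitions. -/
abbrev FSMCode := ℕ × ℕ × List TransitionCode

variable {n : ℕ} {A : Type*} [DecidableEq A] {Γ : Interface n A}

/-- `ν` names the symbols by natural numbers, distinct symbols of a port by distinct numbers. -/
def IsNaming (Γ : Interface n A) (ν : A → ℕ) : Prop :=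
  ∀ p, Set.InjOn ν (Γ.Act p : Set A)

/-- The code `c` describes the alphabets `Γ` under the naming `ν`. -/
def InterfaceCode.Describes (ν : A → ℕ) (c : InterfaceCode) (Γ : Interface n A) : Prop :=
  c.map (fun l => (l.1.toFinset, l.2.toFinset)) =
    List.ofFn fun p => ((Γ.I p).image ν, (Γ.O p).image ν)

/-- The code `c` describes the machine `M` under the naming `ν` of symbols and some numbering of the
states: it lists exactly the transitions of `M`. -/
def FSMCode.Describes (ν : A → ℕ) (c : FSMCode) (M : FSM Γ) : Prop :=
  ∃ e : M.S ≃ Fin c.1, c.2.1 = e M.init ∧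
    ∀ t : TransitionCode, t ∈ c.2.2 ↔
      ∃ (s : M.S) (x : Γ.Input) (s' : M.S) (y : Γ.Output), (s', y) ∈ M.h s x ∧
        t = (((e s : ℕ), (x.1 : ℕ), ν x.2),
          ((e s' : ℕ), List.ofFn fun p => (y p).map fun z => ν z))

end MultiPort

/-!
Where each port has at most one possible observation, a projection is determined by its length.
Hence two traces are indistinguishable if and only if they contain the same number of observations
at each port, that is, if and only if their Parikh images agree, and conformance is an inclusion of
Parikh images (`indist_iff_parikh`). The Parikh image of a trace is the sum of the images of its
labels, so the Parikh image of the language of a machine is the set of weights of the walks from the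
initial vertex of a finite graph with edges weighted by vectors. Such sets are semilinear by the
recursion of Kleene's theorem over the permitted intermediate vertices (`isSemilinearSet_reach`):
semilinear sets are closed under unions, sums and generated submonoids.

For decidability it suffices that both the inclusion of the sets of weights for two graphs `N` and
`M` and its failure have certificates that can be checked (`exists_computable_of_certificates`).

* Failure is witnessed by a walk of `N`. Each transition consumes an input, so only the finitely
  many walks of `M` whose length is at most the sum of the entries of its weight have to be compared
  with it (`exists_refutes_iff`).
* Inclusion holds if each vertex `s` of `N` can be assigned a set `X s`, and each vertex `t` of `M`
  a set `Y t`, such that the sets `X s` are closed under the edges of `N`, their elements lie in sets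
  `Y t`, and each element of a `Y t` is the null vector, with `t` initial, or arises along an edge
  of `M` from an element of some `Y t'`. As the weights are nonzero, induction shows that the elements
  of `Y t` are weights of walks of `M`. If inclusion holds, the sets of weights themselves are such
  an assignment. Being semilinear, they are recognized by a finite automaton that reads the binary
  digits of all coordinates simultaneously (`exists_digitCongr_of_isSemilinearSet`), and so is the
  behaviour of the sets at all vectors `x + u` with entries of `u` at most `2`, which is where the
  edges lead. A certificate is a table of such an automaton; the conditions on the sets become
  conditions on its finitely many states (`Certificate.Valid.sound`, `Certificate.exists_valid`).
-/

/-! ### Weights of walks in a weighted graph -/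

section Walks

open scoped Pointwise

variable {σ V : Type*} [AddCommMonoid V]

/-- `Reach E s₀ t x`: there is a walk from `s₀` to `t` of total weight `x` in the graph in which
`E s v t` says that there is an edge of weight `v` from `s` to `t`. -/
inductive Reach (E : σ → V → σ → Prop) (s₀ : σ) : σ → V → Prop
  | refl : Reach E s₀ s₀ 0
  | step {s t : σ} {x v : V} : Reach E s₀ s x → E s v t → Reach E s₀ t (x + v)

/-- `Walk E U s v t`: there is a nonempty walk of total weight `v` from `s` to `t` all of whose
intermediate vertices lie in `U`. -/
inductive Walk (E : σ → V → σ → Prop) (U : Set σ) : σ → V → σ → Prop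
  | edge {s t : σ} {v : V} : E s v t → Walk E U s v t
  | cons {s u t : σ} {v w : V} : E s v u → u ∈ U → Walk E U u w t → Walk E U s (v + w) t

variable {E : σ → V → σ → Prop} {U U' : Set σ}

theorem Walk.mono (hU : U ⊆ U') {s t : σ} {v : V} (h : Walk E U s v t) : Walk E U' s v t := by
  induction h with
  | edge h => exact .edge h
  | cons h hu _ ih => exact .cons h (hU hu) ih

theorem Walk.trans {s u t : σ} {v w : V} (h : Walk E U s v u) (hu : u ∈ U)
    (h' : Walk E U u w t) : Walk E U s (v + w) t := by
  induction h with
  | edge h => exact .cons h hu h'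
  | cons h hx _ ih => rw [add_assoc]; exact .cons h hx (ih hu h')

/-- A walk through `u ∈ U` can be extended at `u` by any number of closed walks. -/
theorem Walk.add_closure {s u : σ} {v w : V} (h : Walk E U s v u) (hu : u ∈ U)
    (hw : w ∈ AddSubmonoid.closure {c | Walk E U u c u}) : Walk E U s (v + w) u := by
  induction hw using AddSubmonoid.closure_induction generalizing v with
  | mem c hc => exact h.trans hu hc
  | zero => simpa using h
  | add a b _ _ iha ihb => rw [← add_assoc]; exact ihb (iha h)

/-- The recursion of Kleene's theorem: a walk with intermediate vertices in `insert u U` either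
avoids `u`, or consists of a walk to `u`, closed walks at `u` and a walk from `u`. -/
theorem setOf_walk_insert (u s t : σ) :
    {v | Walk E (insert u U) s v t} = {v | Walk E U s v t} ∪
      ({v | Walk E U s v u} + (AddSubmonoid.closure {v | Walk E U u v u} : Set V) +
        {v | Walk E U u v t}) := by
  have hU : U ⊆ insert u U := Set.subset_insert u U
  have hu : u ∈ insert u U := Set.mem_insert u U
  ext x
  constructor
  · intro h
    replace h : Walk E (insert u U) s x t := h
    induction h with
    | edge h => exact .inl (.edge h)
    | @cons s u' t v w h hu' _ ih =>
      rcases ih with ih | ⟨_, ⟨a, ha, c, hc, rfl⟩, b, hb, rfl⟩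
      · rcases hu' with rfl | hu'
        · exact .inr ⟨_, ⟨v, .edge h, 0, zero_mem _, rfl⟩, w, ih, by simp⟩
        · exact .inl (.cons h hu' ih)
      · right
        rcases hu' with rfl | hu'
        · exact ⟨_, ⟨v, .edge h, a + c, add_mem (AddSubmonoid.subset_closure ha) hc, rfl⟩, b, hb,
            by simp [add_assoc]⟩
        · exact ⟨_, ⟨v + a, .cons h hu' ha, c, hc, rfl⟩, b, hb, by simp [add_assoc]⟩
  · rintro (h | ⟨_, ⟨a, ha, c, hc, rfl⟩, b, hb, rfl⟩)
    · exact Walk.mono hU h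
    · have hc' : c ∈ AddSubmonoid.closure {c | Walk E (insert u U) u c u} :=
        AddSubmonoid.closure_mono (fun _ h => Walk.mono hU h) hc
      exact ((Walk.mono hU ha).add_closure hu hc').trans hu (Walk.mono hU hb)

theorem isSemilinearSet_walk (hE : ∀ s t, {v | E s v t}.Finite) (hU : U.Finite) (s t : σ) :
    IsSemilinearSet {v | Walk E U s v t} := by
  induction U, hU using Set.Finite.induction_on generalizing s t with
  | empty =>
    refine .of_finite ((hE s t).subset fun v hv => ?_)
    cases (show Walk E ∅ s v t from hv) with
    | edge h => exact h
    | cons _ h => exact h.elim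
  | insert _ _ ih =>
    rw [setOf_walk_insert]
    exact (ih s t).union (((ih _ _).add (ih _ _).closure).add (ih _ _))

theorem reach_iff_walk (hU : ∀ s v t, E s v t → t ∈ U) (s₀ t : σ) (x : V) :
    Reach E s₀ t x ↔ (t = s₀ ∧ x = 0) ∨ Walk E U s₀ x t := by
  constructor
  · intro h
    induction h with
    | refl => exact .inl ⟨rfl, rfl⟩
    | @step s t x v hs h ih =>
      right
      rcases ih with ⟨rfl, rfl⟩ | ih
      · rw [zero_add]; exact .edge h
      · refine ih.trans ?_ (.edge h)
        clear hs h
        induction ih with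
        | edge h => exact hU _ _ _ h
        | cons _ _ _ ih => exact ih
  · rintro (⟨rfl, rfl⟩ | h)
    · exact .refl
    · suffices ∀ y s, Walk E U s x t → Reach E s₀ s y → Reach E s₀ t (y + x) by
        simpa using this 0 s₀ h .refl
      clear h
      intro y s h hs
      induction h generalizing y with
      | edge h => exact hs.step h
      | cons h _ _ ih => rw [← add_assoc]; exact ih _ (hs.step h)

/-- **Parikh's theorem** for finite weighted graphs. -/
theorem isSemilinearSet_reach (hE : ∀ s t, {v | E s v t}.Finite) (hU : U.Finite)
    (hEU : ∀ s v t, E s v t → t ∈ U) (s₀ t : σ) : IsSemilinearSet {x | Reach E s₀ t x} := by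
  simp only [reach_iff_walk hEU, Set.ofPred_or]
  refine .union (.of_finite ((Set.finite_singleton 0).subset ?_)) (isSemilinearSet_walk hE hU s₀ t)
  rintro x ⟨-, rfl⟩
  rfl

end Walks

namespace MultiPort

/-! ### Traces of machines and walks in weighted graphs -/

namespace FSM

variable {n : ℕ} {A V : Type*} {Γ : Interface n A} [AddCommMonoid V]

/-- The graph of a machine whose edges carry the weights that `w` gives to the labels of the
transitions. -/
def Edge (M : FSM Γ) (w : Γ.Input × Γ.Output → V) (s : M.S) (v : V) (t : M.S) : Prop :=
  ∃ a : Γ.Input × Γ.Output, (t, a.2) ∈ M.h s a.1 ∧ v = w a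

theorem Path.snoc {M : FSM Γ} {s t u : M.S} {σ : Γ.Trace} {a : Γ.Input × Γ.Output}
    (h : M.Path s σ t) (ha : (u, a.2) ∈ M.h t a.1) : M.Path s (σ ++ [a]) u := by
  induction h with
  | nil => exact .cons ha (.nil _)
  | cons h _ ih => exact .cons h (ih ha)

theorem reach_edge_iff (M : FSM Γ) (w : Γ.Input × Γ.Output → V) (t : M.S) (x : V) :
    Reach (M.Edge w) M.init t x ↔ ∃ σ, M.Path M.init σ t ∧ (σ.map w).sum = x := by
  constructor
  · intro h
    induction h with
    | refl => exact ⟨[], .nil _, rfl⟩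
    | step _ h ih =>
      obtain ⟨σ, hσ, rfl⟩ := ih
      obtain ⟨a, ha, rfl⟩ := h
      exact ⟨σ ++ [a], hσ.snoc ha, by simp⟩
  · rintro ⟨σ, hσ, rfl⟩
    suffices ∀ (s : M.S) (y : V), M.Path s σ t → Reach (M.Edge w) M.init s y →
        Reach (M.Edge w) M.init t (y + (σ.map w).sum) by
      simpa using this M.init 0 hσ .refl
    clear hσ
    intro s y h hs
    induction h generalizing y with
    | nil => simpa using hs
    | cons h _ ih =>
      rw [List.map_cons, List.sum_cons, ← add_assoc]
      exact ih _ (hs.step ⟨_, h, rfl⟩)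

theorem isSemilinearSet_weights (M : FSM Γ) (w : Γ.Input × Γ.Output → V) :
    IsSemilinearSet {x | ∃ σ ∈ M.lang, (σ.map w).sum = x} := by
  have := M.finite
  have h : {x | ∃ σ ∈ M.lang, (σ.map w).sum = x} = ⋃ t, {x | Reach (M.Edge w) M.init t x} := by
    ext x
    simp only [reach_edge_iff, Set.mem_iUnion, Set.mem_ofPred_eq, lang]
    constructor
    · rintro ⟨σ, ⟨t, ht⟩, rfl⟩; exact ⟨t, σ, ht, rfl⟩
    · rintro ⟨t, σ, ht, rfl⟩; exact ⟨σ, ⟨t, ht⟩, rfl⟩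
  rw [h]
  refine .iUnion fun t => isSemilinearSet_reach (fun s t => ?_) Set.finite_univ
    (fun _ _ _ _ => Set.mem_univ _) _ _
  refine (Set.finite_range w).subset ?_
  rintro v ⟨a, -, rfl⟩
  exact ⟨a, rfl⟩

end FSM

/-! ### Ports with at most one observation -/

namespace Interface

variable {n : ℕ} {A : Type*} [DecidableEq A] (Γ : Interface n A)

theorem parikh_word (σ : Γ.Trace) :
    Γ.parikh (Γ.word σ) = (σ.map fun a => Γ.parikh (Γ.word [a])).sum := by
  induction σ with
  | nil => ext; simp [word, parikh]
  | cons a σ ih =>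
    obtain ⟨⟨q, x⟩, y⟩ := a
    rw [List.map_cons, List.sum_cons, ← ih]
    ext
    simp [word, parikh, List.count_cons, List.count_append]
    omega

theorem parikh_word_apply (σ : Γ.Trace) (p : Fin n) (a : Γ.Obs p) :
    Γ.parikh (Γ.word σ) ⟨p, a⟩ = (Γ.proj p σ).count a := by
  have hflat : ∀ y : Γ.Output, (((List.finRange n).flatMap fun p =>
      ((y p).map fun z => (⟨p, Γ.obsOut z⟩ : Γ.Letter)).toList).count ⟨p, a⟩) =
        ((y p).map Γ.obsOut).toList.count a := by
    intro y
    rw [List.count_flatMap, ← Fin.sum_univ_def, Finset.sum_eq_single p]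
    · rcases h : y p with _ | z <;> simp [h, List.count_singleton, beq_eq_decide]
    · intro q _ hq
      rcases h : y q with _ | z <;> simp [h, hq]
    · simp
  induction σ with
  | nil => simp [word, proj, parikh]
  | cons b σ ih =>
    obtain ⟨⟨q, x⟩, y⟩ := b
    simp only [parikh] at ih
    simp only [word, proj, parikh, List.count_append, List.count_cons, hflat, ih, List.cons_append]
    have : (if (⟨q, Γ.obsIn x⟩ : Γ.Letter) == ⟨p, a⟩ then 1 else 0) =
        List.count a (if h : q = p then [Γ.obsIn (h ▸ x)] else []) := by
      by_cases h : q = p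
      · subst h
        simp [List.count_singleton, beq_eq_decide]
      · simp [h]
    omega

theorem indist_iff_length (hΓ : ∀ p, (Γ.Act p).card ≤ 1) (σ σ' : Γ.Trace) :
    Γ.Indist σ σ' ↔ ∀ p, (Γ.proj p σ).length = (Γ.proj p σ').length := by
  refine ⟨fun h p => by rw [h p], fun h p => List.ext_getElem (h p) fun i _ _ => Subtype.ext ?_⟩
  exact Finset.card_le_one.1 (hΓ p) _ (Subtype.property _) _ (Subtype.property _)

theorem indist_iff_parikh (hΓ : ∀ p, (Γ.Act p).card ≤ 1) (σ σ' : Γ.Trace) :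
    Γ.Indist σ σ' ↔ Γ.parikh (Γ.word σ) = Γ.parikh (Γ.word σ') := by
  constructor
  · intro h
    ext ⟨p, a⟩
    rw [parikh_word_apply, parikh_word_apply, h p]
  · intro h
    rw [indist_iff_length Γ hΓ]
    intro p
    have hcount : ∀ (a : Γ.Obs p) (l : List (Γ.Obs p)), l.count a = l.length := by
      intro a l
      refine List.count_eq_length.2 fun b _ => Subtype.ext ?_
      exact Finset.card_le_one.1 (hΓ p) _ a.2 _ b.2
    by_cases hp : Nonempty (Γ.Obs p)
    · obtain ⟨a⟩ := hp
      have := congrFun h ⟨p, a⟩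
      rwa [parikh_word_apply, parikh_word_apply, hcount, hcount] at this
    · have := not_nonempty_iff.1 hp
      rw [Subsingleton.elim (Γ.proj p σ) (Γ.proj p σ')]

end Interface

variable {n : ℕ} {A : Type*} [DecidableEq A] {Γ : Interface n A}

theorem isSemilinearSet_parikhImage_lang (M : FSM Γ) :
    IsSemilinearSet (Γ.parikhImage M.lang) := by
  have h := M.isSemilinearSet_weights fun a => Γ.parikh (Γ.word [a])
  simp only [← Γ.parikh_word] at h
  simpa only [Interface.parikhImage, eq_comm] using h

theorem stronglyConforms_iff_parikhImage_subset (hΓ : ∀ p, (Γ.Act p).card ≤ 1) (N M : FSM Γ) :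
    N.StronglyConforms M ↔ Γ.parikhImage N.lang ⊆ Γ.parikhImage M.lang := by
  simp only [FSM.StronglyConforms, Γ.indist_iff_parikh hΓ]
  constructor
  · rintro h _ ⟨σ, hσ, rfl⟩
    obtain ⟨σ', hσ', he⟩ := h σ hσ
    exact ⟨σ', hσ', he.symm⟩
  · intro h σ hσ
    obtain ⟨σ', hσ', he⟩ := h ⟨σ, hσ, rfl⟩
    exact ⟨σ', hσ', he.symm⟩

end MultiPort

/-! ### Semilinear sets and binary digits -/

section Digits

open scoped Pointwise

variable {ι Q : Type*}

/-- The map `q` on vectors can be computed by an automaton that reads the binary digits of all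
coordinates simultaneously, the most significant digits first: the value at `2 • x + b`, where `b`
is a vector of digits, only depends on `b` and on the value at `x`. -/
def DigitCongr (q : (ι → ℕ) → Q) : Prop :=
  ∀ x x' b : ι → ℕ, b ≤ 1 → q x = q x' → q (2 • x + b) = q (2 • x' + b)

/-- The states of the automaton are the sets of offsets `e`, within a fixed bound, such that the
input read so far lies in the translate by `e` of the periods' span. Appending digits doubles the
input, so that an offset is updated by halving, which keeps it within the bound. -/
theorem IsLinearSet.exists_digitCongr {ι : Type} [Finite ι] {s : Set (ι → ℕ)}
    (hs : IsLinearSet s) : ∃ (Q : Type) (_ : Finite Q) (q : (ι → ℕ) → Q), DigitCongr q ∧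
      ∀ x x', q x = q x' → (x ∈ s ↔ x' ∈ s) := by
  classical
  cases nonempty_fintype ι
  obtain ⟨c, t, rfl⟩ := isLinearSet_iff.1 hs
  -- The bound is preserved: halving an offset, after adding at most the sum of the periods and
  -- subtracting a digit, does not lead out of it.
  let B : ι → ℤ := fun i => c i + 1 + ∑ a ∈ t, (a i : ℤ)
  let κ : (ι → ℤ) → (ι → ℕ) → Prop := fun e x =>
    ∃ f : (ι → ℕ) → ℕ, ∀ i, (x i : ℤ) = e i + ∑ a ∈ t, (f a : ℤ) * a i
  have hmem : ∀ x, x ∈ c +ᵥ (AddSubmonoid.closure (t : Set (ι → ℕ)) : Set (ι → ℕ)) ↔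
      κ (fun i => c i) x := by
    intro x
    rw [Set.mem_vadd_set]
    constructor
    · rintro ⟨y, hy, rfl⟩
      obtain ⟨f, -, rfl⟩ := AddSubmonoid.mem_closure_finset.1 hy
      exact ⟨f, fun i => by simp [Finset.sum_apply]⟩
    · rintro ⟨f, hf⟩
      refine ⟨∑ a ∈ t, f a • a, sum_mem fun a ha =>
        nsmul_mem (AddSubmonoid.subset_closure ha) _, ?_⟩
      ext i
      have : (x i : ℤ) = c i + ∑ a ∈ t, (f a : ℤ) * a i := hf i
      simp only [vadd_eq_add, Pi.add_apply, Finset.sum_apply, Pi.smul_apply, smul_eq_mul]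
      exact_mod_cast this.symm
  have hstep : ∀ e ∈ Set.Icc (-B) B, ∀ b : ι → ℕ, b ≤ 1 → ∀ x, κ e (2 • x + b) ↔
      ∃ e' ∈ Set.Icc (-B) B, (∃ d : (ι → ℕ) → ℕ, ∀ i,
        2 * e' i = e i - b i + ∑ a ∈ t, (d a : ℤ) * a i) ∧ κ e' x := by
    intro e he b hb x
    constructor
    · rintro ⟨f, hf⟩
      have hsplit : ∀ i, ∑ a ∈ t, (f a : ℤ) * a i = 2 * ∑ a ∈ t, ((f a / 2 : ℕ) : ℤ) * a i +
          ∑ a ∈ t, ((f a % 2 : ℕ) : ℤ) * a i := by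
        intro i
        rw [Finset.mul_sum, ← Finset.sum_add_distrib]
        refine Finset.sum_congr rfl fun a _ => ?_
        have : (f a : ℤ) = 2 * ((f a / 2 : ℕ) : ℤ) + ((f a % 2 : ℕ) : ℤ) := by omega
        rw [this]; push_cast; ring
      have hd : ∀ i, 0 ≤ ∑ a ∈ t, ((f a % 2 : ℕ) : ℤ) * a i ∧
          ∑ a ∈ t, ((f a % 2 : ℕ) : ℤ) * a i ≤ ∑ a ∈ t, (a i : ℤ) := by
        intro i
        refine ⟨Finset.sum_nonneg fun a _ => by positivity, Finset.sum_le_sum fun a _ => ?_⟩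
        have : ((f a % 2 : ℕ) : ℤ) ≤ 1 := by omega
        nlinarith [Int.natCast_nonneg (a i)]
      have he' : ∀ i, 2 * ((x i : ℤ) - ∑ a ∈ t, ((f a / 2 : ℕ) : ℤ) * a i) =
          e i - b i + ∑ a ∈ t, ((f a % 2 : ℕ) : ℤ) * a i := by
        intro i
        have h₁ := hf i
        have h₂ := hsplit i
        simp only [Pi.add_apply, Pi.smul_apply, smul_eq_mul, Nat.cast_add, Nat.cast_mul,
          Nat.cast_ofNat] at h₁
        linarith
      refine ⟨fun i => x i - ∑ a ∈ t, ((f a / 2 : ℕ) : ℤ) * a i, ?_,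
        ⟨fun a => f a % 2, he'⟩, fun a => f a / 2, fun i => by simp⟩
      have key : ∀ i, -B i ≤ (x i : ℤ) - ∑ a ∈ t, ((f a / 2 : ℕ) : ℤ) * a i ∧
          (x i : ℤ) - ∑ a ∈ t, ((f a / 2 : ℕ) : ℤ) * a i ≤ B i := by
        intro i
        have h₁ := he' i
        have h₂ := hd i
        have h₃ : -B i ≤ e i := he.1 i
        have h₄ : e i ≤ B i := he.2 i
        have h₅ : b i ≤ 1 := hb i
        have h₆ : B i = c i + 1 + ∑ a ∈ t, (a i : ℤ) := rfl
        constructor <;> omega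
      exact ⟨fun i => (key i).1, fun i => (key i).2⟩
    · rintro ⟨e', -, ⟨d, hd⟩, f, hf⟩
      refine ⟨fun a => 2 * f a + d a, fun i => ?_⟩
      have h₁ := hd i
      have h₂ := hf i
      have h₃ : ∑ a ∈ t, ((2 * f a + d a : ℕ) : ℤ) * a i =
          2 * ∑ a ∈ t, (f a : ℤ) * a i + ∑ a ∈ t, (d a : ℤ) * a i := by
        rw [Finset.mul_sum, ← Finset.sum_add_distrib]
        refine Finset.sum_congr rfl fun a _ => ?_
        push_cast; ring
      simp only [Pi.add_apply, Pi.smul_apply, smul_eq_mul, Nat.cast_add, Nat.cast_mul,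
        Nat.cast_ofNat] at h₃ ⊢
      linarith
  refine ⟨Set (Set.Icc (-B) B), inferInstance, fun x => {e | κ e x}, ?_, ?_⟩
  · intro x x' b hb h
    have hκ : ∀ e ∈ Set.Icc (-B) B, κ e x ↔ κ e x' := fun e he => Set.ext_iff.1 h ⟨e, he⟩
    ext ⟨e, he⟩
    change κ e _ ↔ κ e _
    rw [hstep e he b hb, hstep e he b hb]
    exact exists_congr fun e' => and_congr_right fun he' => and_congr_right fun _ => hκ e' he'
  · intro x x' h
    rw [hmem, hmem]
    have hB : ∀ i, 0 ≤ ∑ a ∈ t, (a i : ℤ) := fun i => Finset.sum_nonneg fun a _ => by positivity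
    refine Set.ext_iff.1 h ⟨fun i => c i, fun i => ?_, fun i => ?_⟩
    · have := hB i
      change -((c i : ℤ) + 1 + ∑ a ∈ t, (a i : ℤ)) ≤ c i
      omega
    · have := hB i
      change (c i : ℤ) ≤ (c i : ℤ) + 1 + ∑ a ∈ t, (a i : ℤ)
      omega

theorem exists_digitCongr_of_isSemilinearSet {ι I : Type} [Finite ι] [Finite I]
    (F : I → Set (ι → ℕ)) (hF : ∀ i, IsSemilinearSet (F i)) :
    ∃ (Q : Type) (_ : Finite Q) (q : (ι → ℕ) → Q), DigitCongr q ∧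
      ∀ i x x', q x = q x' → (x ∈ F i ↔ x' ∈ F i) := by
  choose S hS hlin hSF using hF
  have := fun i => (hS i).to_subtype
  choose Q hQ q hq hqF using fun j : Σ i, S i => (hlin j.1 j.2 j.2.2).exists_digitCongr
  refine ⟨∀ j, Q j, inferInstance, fun x j => q j x, ?_, ?_⟩
  · intro x x' b hb h
    funext j
    exact hq j x x' b hb (congrFun h j)
  · intro i x x' h
    rw [hSF]
    exact exists_congr fun s => and_congr_right fun hs => hqF ⟨i, s, hs⟩ x x' (congrFun h _)

theorem mod_two_le_one (x : ι → ℕ) : (fun i => x i % 2) ≤ 1 := fun i => by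
  simp only [Pi.one_apply]; omega

end Digits

/-! ### Certificates of inclusion -/

/-- The function defined by recursion on the binary digits of a vector, by the rule
`r x = S (r (x / 2)) (x % 2)` and the initial value `r₀`. -/
noncomputable def digitRec {d : ℕ} (S : ℕ → (Fin d → ℕ) → ℕ) (r₀ : ℕ) (x : Fin d → ℕ) : ℕ :=
  if x = 0 then r₀ else S (digitRec S r₀ fun i => x i / 2) fun i => x i % 2
termination_by ∑ i, x i
decreasing_by
  rename_i h
  obtain ⟨i, hi⟩ := Function.ne_iff.1 h
  exact Finset.sum_lt_sum (fun i _ => Nat.div_le_self _ _)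
    ⟨i, Finset.mem_univ i, Nat.div_lt_self (Nat.pos_of_ne_zero hi) one_lt_two⟩

section DigitRec

variable {d : ℕ} {S : ℕ → (Fin d → ℕ) → ℕ} {r₀ : ℕ}

theorem digitRec_zero : digitRec S r₀ 0 = r₀ := by
  rw [digitRec]; simp

theorem digitRec_eq (hS : S r₀ 0 = r₀) (x : Fin d → ℕ) :
    digitRec S r₀ x = S (digitRec S r₀ fun i => x i / 2) fun i => x i % 2 := by
  by_cases h : x = 0
  · subst h
    have h₁ : (fun i => (0 : Fin d → ℕ) i / 2) = 0 := by ext; simp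
    have h₂ : (fun i => (0 : Fin d → ℕ) i % 2) = 0 := by ext; simp
    rw [h₁, h₂, digitRec_zero, hS]
  · rw [digitRec, if_neg h]

theorem digit_induction {P : (Fin d → ℕ) → Prop} (zero : P 0)
    (step : ∀ x, P (fun i => x i / 2) → P x) (x : Fin d → ℕ) : P x := by
  induction hn : ∑ i, x i using Nat.strong_induction_on generalizing x with
  | _ n ih =>
    by_cases h : x = 0
    · exact h ▸ zero
    · obtain ⟨i, hi⟩ := Function.ne_iff.1 h
      exact step x (ih _ (hn ▸ Finset.sum_lt_sum (fun i _ => Nat.div_le_self _ _)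
        ⟨i, Finset.mem_univ i, Nat.div_lt_self (Nat.pos_of_ne_zero hi) one_lt_two⟩) _ rfl)

end DigitRec

namespace MultiPort

/-- The graph described by a list of transitions, weighted by `W`. -/
def FSMCode.Edge {d : ℕ} (W : TransitionCode → Fin d → ℕ) (c : FSMCode) (s : ℕ) (v : Fin d → ℕ)
    (t : ℕ) : Prop :=
  ∃ e ∈ c.2.2, e.1.1 = s ∧ e.2.1 = t ∧ v = W e

/-- A certificate consists of numbers `m`, `r₀`, `k` and of tables, which `lookup` turns into
functions. -/
abbrev Certificate := (ℕ × ℕ × ℕ) × (List ℕ × List ℕ × List ℕ) × (List ℕ × List ℕ × List ℕ)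

/-- The table `T` read as a function on a type of keys. -/
def lookup {κ : Type*} [Encodable κ] (T : List ℕ) (a : κ) : ℕ := T.getD (Encodable.encode a) 0

theorem exists_lookup_eq {κ : Type*} [Encodable κ] {D : Set κ} (hD : D.Finite) (g : κ → ℕ) :
    ∃ T : List ℕ, ∀ a ∈ D, lookup T a = g a := by
  obtain ⟨B, hB⟩ := (hD.image Encodable.encode).bddAbove
  refine ⟨(List.range (B + 1)).map fun j => ((Encodable.decode j : Option κ).map g).getD 0,
    fun a ha => ?_⟩
  have : Encodable.encode a < B + 1 := Nat.lt_succ_of_le (hB ⟨a, ha, rfl⟩)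
  simp [lookup, this]

namespace Certificate

variable {d : ℕ}

/-- The number of states of the automaton. -/
abbrev card (C : Certificate) : ℕ := C.1.1

/-- The initial state of the automaton. -/
abbrev start (C : Certificate) : ℕ := C.1.2.1

/-- A bound for the vertices of the two graphs. -/
abbrev bound (C : Certificate) : ℕ := C.1.2.2

/-- The transitions of the automaton. -/
def next (C : Certificate) (r : ℕ) (b : Fin d → ℕ) : ℕ := lookup C.2.1.1 (r, List.ofFn b)

/-- If the automaton is in state `r` after reading `x`, then `C.near r u` is the colour of the
vector `x + u`. -/
def near (C : Certificate) (r : ℕ) (u : Fin d → ℕ) : ℕ := lookup C.2.1.2.1 (r, List.ofFn u)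

/-- The colour of `2 • x + b`, given the colour of `x`. -/
def nextColour (C : Certificate) (q : ℕ) (b : Fin d → ℕ) : ℕ :=
  lookup C.2.1.2.2 (q, List.ofFn b)

/-- If the automaton is in state `r` after reading `x`, then `C.coord r i` vanishes if and only if
`x i` does. -/
def coord (C : Certificate) (r : ℕ) (i : ℕ) : ℕ := lookup C.2.2.1 (r, i)

/-- The vectors of colour `q` belong to the set assigned to the vertex `s` of the first graph. -/
def InFst (C : Certificate) (q s : ℕ) : Prop := lookup C.2.2.2.1 (q, s) = 1

/-- The vectors of colour `q` belong to the set assigned to the vertex `s` of the second graph. -/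
def InSnd (C : Certificate) (q s : ℕ) : Prop := lookup C.2.2.2.2 (q, s) = 1

/-- The conditions, on finitely many table entries, under which `C` proves that each weight of a
walk from the initial vertex of `N` is the weight of such a walk of `M`: the sets assigned to the
vertices of `N` are closed under the edges of `N`, they are covered by the sets assigned to the
vertices of `M`, and each element of the latter arises along an edge of `M` or is the weight of the
empty walk. -/
structure Valid (C : Certificate) (W : TransitionCode → Fin d → ℕ) (N M : FSMCode) : Prop where
  start_lt : C.start < C.card
  next_start : C.next C.start (0 : Fin d → ℕ) = C.start
  coord_start : ∀ i : Fin d, C.coord C.start i = 0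
  next_lt : ∀ r < C.card, ∀ b : Fin d → ℕ, b ≤ 1 → C.next r b < C.card
  coord_next : ∀ r < C.card, ∀ b : Fin d → ℕ, b ≤ 1 → ∀ i : Fin d,
    C.coord (C.next r b) i = 0 ↔ C.coord r i = 0 ∧ b i = 0
  near_next : ∀ r < C.card, ∀ b : Fin d → ℕ, b ≤ 1 → ∀ u : Fin d → ℕ, u ≤ 2 →
    C.near (C.next r b) u =
      C.nextColour (C.near r fun i => (b i + u i) / 2) fun i => (b i + u i) % 2
  init_lt : N.2.1 < C.bound
  inFst_init : C.InFst (C.near C.start (0 : Fin d → ℕ)) N.2.1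
  edge_lt : ∀ e ∈ N.2.2, e.2.1 < C.bound
  inFst_edge : ∀ r < C.card, ∀ e ∈ N.2.2, C.InFst (C.near r (0 : Fin d → ℕ)) e.1.1 →
    C.InFst (C.near r (W e)) e.2.1
  cover : ∀ r < C.card, ∀ s < C.bound, C.InFst (C.near r (0 : Fin d → ℕ)) s →
    ∃ t < C.bound, C.InSnd (C.near r (0 : Fin d → ℕ)) t
  inSnd : ∀ r < C.card, ∀ u : Fin d → ℕ, u ≤ 2 → (∀ i : Fin d, C.coord r i = 0 ∨ u i = 2) →
    ∀ t < C.bound, C.InSnd (C.near r u) t →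
      (t = M.2.1 ∧ ∀ i : Fin d, C.coord r i = 0 ∧ u i = 0) ∨
      ∃ e ∈ M.2.2, e.2.1 = t ∧ e.1.1 < C.bound ∧ (∀ i : Fin d, W e i ≤ u i) ∧
        C.InSnd (C.near r fun i => u i - W e i) e.1.1

variable {W : TransitionCode → Fin d → ℕ} {N M : FSMCode}

theorem Valid.sound {C : Certificate} (hC : C.Valid W N M) (hW : ∀ e, W e ≤ 2)
    (hW₀ : ∀ e, W e ≠ 0) {s : ℕ} {x : Fin d → ℕ} (h : Reach (N.Edge W) N.2.1 s x) :
    ∃ t, Reach (M.Edge W) M.2.1 t x := by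
  let r : (Fin d → ℕ) → ℕ := digitRec C.next C.start
  have hr : ∀ x, r x = C.next (r fun i => x i / 2) fun i => x i % 2 := digitRec_eq hC.next_start
  have hr₀ : r 0 = C.start := digitRec_zero
  have hlt : ∀ x, r x < C.card := by
    intro x
    induction x using digit_induction with
    | zero => rw [hr₀]; exact hC.start_lt
    | step x ih => rw [hr]; exact hC.next_lt _ ih _ (mod_two_le_one x)
  have hcoord : ∀ x (i : Fin d), C.coord (r x) i = 0 ↔ x i = 0 := by
    intro x
    induction x using digit_induction with
    | zero => intro i; simp [hr₀, hC.coord_start]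
    | step x ih =>
      intro i
      rw [hr, hC.coord_next _ (hlt _) _ (mod_two_le_one x), ih]
      change x i / 2 = 0 ∧ x i % 2 = 0 ↔ x i = 0
      omega
  let q : (Fin d → ℕ) → ℕ := fun x => C.near (r x) (0 : Fin d → ℕ)
  have hq : ∀ x, q x = C.nextColour (q fun i => x i / 2) fun i => x i % 2 := by
    intro x
    have h₁ : (fun i => (x i % 2 + (0 : Fin d → ℕ) i) / 2) = 0 := by
      ext i; simp only [Pi.zero_apply]; omega
    have h₂ : (fun i => (x i % 2 + (0 : Fin d → ℕ) i) % 2) = fun i => x i % 2 := by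
      ext i; simp only [Pi.zero_apply]; omega
    change C.near (r x) 0 = _
    rw [hr, hC.near_next _ (hlt _) _ (mod_two_le_one x) _ zero_le, h₁, h₂]
  -- The tables describe addition consistently, since the automaton propagates the carries.
  have hnear₀ : ∀ u : Fin d → ℕ, u ≤ 2 → C.near C.start u = q u := by
    intro u
    induction u using digit_induction with
    | zero => intro _; rw [← hr₀]
    | step u ih =>
      intro hu
      have hu' : (fun i => u i / 2) ≤ 2 := fun i => (Nat.div_le_self _ _).trans (hu i)
      have := hC.near_next _ hC.start_lt 0 zero_le u hu
      simp only [Pi.zero_apply, zero_add] at this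
      rw [hC.next_start] at this
      rw [this, ih hu', hq u]
  have hnear : ∀ x u : Fin d → ℕ, u ≤ 2 → C.near (r x) u = q (x + u) := by
    intro x
    induction x using digit_induction with
    | zero => intro u hu; rw [hr₀, hnear₀ u hu, zero_add]
    | step x ih =>
      intro u hu
      have hu' : (fun i => (x i % 2 + u i) / 2) ≤ 2 := fun i => by
        have : u i ≤ 2 := hu i
        simp only [Pi.ofNat_apply]
        omega
      have h₁ : (fun i => (x + u) i / 2) = (fun i => x i / 2) + fun i => (x i % 2 + u i) / 2 := by
        ext i; simp only [Pi.add_apply]; omega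
      have h₂ : (fun i => (x + u) i % 2) = fun i => (x i % 2 + u i) % 2 := by
        ext i; simp only [Pi.add_apply]; omega
      rw [hr, hC.near_next _ (hlt _) _ (mod_two_le_one x) u hu, ih _ hu', hq (x + u), h₁, h₂]
  have hfst : s < C.bound ∧ C.InFst (q x) s := by
    induction h with
    | refl => exact ⟨hC.init_lt, by simpa only [q, hr₀] using hC.inFst_init⟩
    | step _ he ih =>
      obtain ⟨e, he, rfl, rfl, rfl⟩ := he
      refine ⟨hC.edge_lt e he, ?_⟩
      rw [← hnear _ _ (hW e)]
      exact hC.inFst_edge _ (hlt _) e he ih.2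
  obtain ⟨t, ht, htx⟩ := hC.cover _ (hlt x) s hfst.1 hfst.2
  refine ⟨t, ?_⟩
  replace htx : C.InSnd (q x) t := htx
  clear h hfst
  induction hn : ∑ i, x i using Nat.strong_induction_on generalizing x t with
  | _ n ih =>
    -- An edge into `x` has entries at most `2`, so the vector from which it leads to `x` is of the
    -- form `x - min x 2 + u` with `u ≤ 2`, and the tables contain its colour.
    have hu : (fun i => min (x i) 2) ≤ 2 := fun i => min_le_right _ _
    have hx : (fun i => x i - min (x i) 2) + (fun i => min (x i) 2) = x := by
      ext i; simp only [Pi.add_apply]; omega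
    have h₁ := hC.inSnd (r fun i => x i - min (x i) 2) (hlt _) _ hu (fun i => by
      rw [hcoord]; omega) t ht (by rw [hnear _ _ hu, hx]; exact htx)
    rcases h₁ with ⟨rfl, h₀⟩ | ⟨e, he, rfl, hlt', hle, hsnd⟩
    · have : x = 0 := by
        ext i
        have := h₀ i
        rw [hcoord] at this
        simp only [Pi.zero_apply]
        omega
      rw [this]
      exact .refl
    · have hle' : ∀ i, W e i ≤ x i := fun i => (hle i).trans (min_le_left _ _)
      have hx' : (fun i => x i - min (x i) 2) + (fun i => min (x i) 2 - W e i) =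
          fun i => x i - W e i := by
        ext i
        have := hle i
        simp only [Pi.add_apply]; omega
      rw [hnear _ _ fun i => (Nat.sub_le _ _).trans (hu i), hx'] at hsnd
      obtain ⟨i, hi⟩ := Function.ne_iff.1 (hW₀ e)
      have hsum : ∑ i, (x i - W e i) < n := by
        rw [← hn]
        refine Finset.sum_lt_sum (fun i _ => Nat.sub_le _ _) ⟨i, Finset.mem_univ i, ?_⟩
        have := hle' i
        simp only [Pi.zero_apply] at hi
        omega
      have := (ih _ hsum _ hlt' hsnd rfl).step ⟨e, he, rfl, rfl, rfl⟩
      convert this using 1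
      ext i
      have := hle' i
      simp only [Pi.add_apply]; omega

end Certificate
/-- The values of a map to a finite type can be numbered; `rep` picks a representative of each
value. -/
theorem exists_numbering {V Q : Type*} [Finite Q] [Inhabited V] (q : V → Q) :
    ∃ (m : ℕ) (num : V → ℕ) (rep : ℕ → V), (∀ x, num x < m) ∧ (∀ x, q (rep (num x)) = q x) ∧
      ∀ x y, q x = q y → num x = num y := by
  classical
  obtain ⟨m, ⟨e⟩⟩ := Finite.exists_equiv_fin (Set.range q)
  choose f hf using fun z : Set.range q => z.2
  refine ⟨m, fun x => e ⟨q x, x, rfl⟩, fun j => if h : j < m then f (e.symm ⟨j, h⟩) else default,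
    fun x => Fin.is_lt _, fun x => ?_, fun x y h => ?_⟩
  · simp [hf]
  · simp [h]

theorem FSMCode.finite_edge {d : ℕ} (W : TransitionCode → Fin d → ℕ) (c : FSMCode) (s t : ℕ) :
    {v | c.Edge W s v t}.Finite := by
  refine (c.2.2.toFinset.image W).finite_toSet.subset ?_
  rintro v ⟨e, he, -, -, rfl⟩
  simp only [Finset.coe_image, Set.mem_image]
  exact ⟨e, by simpa using he, rfl⟩

theorem FSMCode.exists_bound (c : FSMCode) :
    ∃ k, c.2.1 < k ∧ ∀ e ∈ c.2.2, e.1.1 < k ∧ e.2.1 < k := by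
  obtain ⟨k, hk⟩ := (c.2.2.toFinset.image fun e => max e.1.1 e.2.1).bddAbove
  refine ⟨max c.2.1 k + 1, by omega, fun e he => ?_⟩
  have := hk (Finset.mem_coe.2 (Finset.mem_image_of_mem _ (List.mem_toFinset.2 he)))
  omega

theorem FSMCode.isSemilinearSet_reach {d : ℕ} (W : TransitionCode → Fin d → ℕ) (c : FSMCode)
    (t : ℕ) : IsSemilinearSet {x | Reach (c.Edge W) c.2.1 t x} := by
  obtain ⟨k, -, hk⟩ := c.exists_bound
  refine _root_.isSemilinearSet_reach (c.finite_edge W) (Set.finite_Iio k) ?_ _ _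
  rintro _ _ _ ⟨e, he, rfl, rfl, rfl⟩
  exact (hk e he).2

namespace Certificate

variable {d : ℕ} {W : TransitionCode → Fin d → ℕ} {N M : FSMCode}

/-- The sets of the certificate are the sets of weights of walks from the initial vertices. As they
are semilinear, finitely many colours and states suffice. -/
theorem exists_valid (hW : ∀ e, W e ≤ 2) (h : ∀ s x, Reach (N.Edge W) N.2.1 s x →
    ∃ t, Reach (M.Edge W) M.2.1 t x) : ∃ C : Certificate, C.Valid W N M := by
  classical
  obtain ⟨k₁, hN₀, hN⟩ := N.exists_bound
  obtain ⟨k₂, hM₀, hM⟩ := M.exists_bound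
  let k := max k₁ k₂
  obtain ⟨Q, hQ, q, hq, hqF⟩ := exists_digitCongr_of_isSemilinearSet
    (fun i : Fin k ⊕ Fin k => i.elim (fun s : Fin k => {x | Reach (N.Edge W) N.2.1 s x})
      fun s : Fin k => {x | Reach (M.Edge W) M.2.1 s x}) (by
    rintro (s | s)
    · exact N.isSemilinearSet_reach W s
    · exact M.isSemilinearSet_reach W s)
  obtain ⟨m', col, colRep, hcol_lt, hcolRep, hcol⟩ := exists_numbering q
  obtain ⟨m, num, rep, hnum_lt, hrep, -⟩ := exists_numbering
    fun x : Fin d → ℕ => ((fun i => x i = 0 : Fin d → Prop), fun u : Fin d → Fin 3 =>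
      q (x + fun i => (u i : ℕ)))
  have hrep₀ : ∀ x i, rep (num x) i = 0 ↔ x i = 0 := fun x i =>
    iff_of_eq (congrFun (Prod.mk.inj (hrep x)).1 i)
  have hrepu : ∀ x u, u ≤ 2 → q (rep (num x) + u) = q (x + u) := fun x u hu =>
    congrFun (Prod.mk.inj (hrep x)).2 fun i => ⟨u i, Nat.lt_succ_of_le (hu i)⟩
  have hqN : ∀ x s, s < k → (Reach (N.Edge W) N.2.1 s (colRep (col x)) ↔
      Reach (N.Edge W) N.2.1 s x) := fun x s hs => hqF (.inl ⟨s, hs⟩) _ _ (hcolRep x)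
  have hqM : ∀ x s, s < k → (Reach (M.Edge W) M.2.1 s (colRep (col x)) ↔
      Reach (M.Edge W) M.2.1 s x) := fun x s hs => hqF (.inr ⟨s, hs⟩) _ _ (hcolRep x)
  let vec : List ℕ → Fin d → ℕ := fun l i => l.getD i 0
  have hvec : ∀ u, vec (List.ofFn u) = u := fun u => by ext i; simp [vec]
  have hfin : ∀ j : ℕ, (Set.Iio j ×ˢ (List.ofFn '' Set.Iic (2 : Fin d → ℕ))).Finite := fun j =>
    (Set.finite_Iio j).prod ((Set.finite_Iic 2).image _)
  obtain ⟨T₁, h₁⟩ := exists_lookup_eq (hfin m) fun a => num (2 • rep a.1 + vec a.2)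
  obtain ⟨T₂, h₂⟩ := exists_lookup_eq (hfin m) fun a => col (rep a.1 + vec a.2)
  obtain ⟨T₃, h₃⟩ := exists_lookup_eq (hfin m') fun a => col (2 • colRep a.1 + vec a.2)
  obtain ⟨T₄, h₄⟩ := exists_lookup_eq ((Set.finite_Iio m).prod (Set.finite_Iio d))
    fun a => if hi : a.2 < d then rep a.1 ⟨a.2, hi⟩ else 0
  obtain ⟨T₅, h₅⟩ := exists_lookup_eq ((Set.finite_Iio m').prod (Set.finite_Iio k))
    fun a => if Reach (N.Edge W) N.2.1 a.2 (colRep a.1) then 1 else 0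
  obtain ⟨T₆, h₆⟩ := exists_lookup_eq ((Set.finite_Iio m').prod (Set.finite_Iio k))
    fun a => if Reach (M.Edge W) M.2.1 a.2 (colRep a.1) then 1 else 0
  have h12 : (1 : Fin d → ℕ) ≤ 2 := fun i => one_le_two
  -- The state after reading `x` records which coordinates of `x` vanish and the colours of the
  -- vectors `x + u`, where `u ≤ 2`.
  let C : Certificate := ((m, num 0, k), (T₁, T₂, T₃), (T₄, T₅, T₆))
  have hnext : ∀ r < m, ∀ b : Fin d → ℕ, b ≤ 1 → C.next r b = num (2 • rep r + b) := by
    intro r hlt b hb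
    refine (h₁ (r, List.ofFn b) ⟨hlt, b, hb.trans h12, rfl⟩).trans ?_
    simp only [hvec]
  have hnear : ∀ r < m, ∀ u : Fin d → ℕ, u ≤ 2 → C.near r u = col (rep r + u) := by
    intro r hlt u hu
    refine (h₂ (r, List.ofFn u) ⟨hlt, u, hu, rfl⟩).trans ?_
    simp only [hvec]
  have hnextColour : ∀ x b : Fin d → ℕ, b ≤ 1 → C.nextColour (col x) b = col (2 • x + b) := by
    intro x b hb
    refine (h₃ (col x, List.ofFn b) ⟨hcol_lt x, b, hb.trans h12, rfl⟩).trans (hcol _ _ ?_)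
    simp only [hvec]
    exact hq _ _ _ hb (hcolRep x)
  have hcoord : ∀ r < m, ∀ i : Fin d, C.coord r i = rep r i := by
    intro r hlt i
    refine (h₄ (r, (i : ℕ)) ⟨hlt, i.2⟩).trans ?_
    simp
  have hfst : ∀ x, ∀ s < k, C.InFst (col x) s ↔ Reach (N.Edge W) N.2.1 s x := by
    intro x s hs
    rw [← hqN x s hs, InFst, h₅ (col x, s) ⟨hcol_lt x, hs⟩]
    simp
  have hsnd : ∀ x, ∀ s < k, C.InSnd (col x) s ↔ Reach (M.Edge W) M.2.1 s x := by
    intro x s hs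
    rw [← hqM x s hs, InSnd, h₆ (col x, s) ⟨hcol_lt x, hs⟩]
    simp
  have hNk : ∀ e ∈ N.2.2, e.1.1 < k ∧ e.2.1 < k := fun e he =>
    ⟨(hN e he).1.trans_le (le_max_left _ _), (hN e he).2.trans_le (le_max_left _ _)⟩
  have hMk : ∀ e ∈ M.2.2, e.1.1 < k ∧ e.2.1 < k := fun e he =>
    ⟨(hM e he).1.trans_le (le_max_right _ _), (hM e he).2.trans_le (le_max_right _ _)⟩
  have hNlt : ∀ s x, Reach (N.Edge W) N.2.1 s x → s < k := by
    rintro s x (_ | ⟨-, ⟨e, he, -, rfl, -⟩⟩)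
    · exact hN₀.trans_le (le_max_left _ _)
    · exact (hNk e he).2
  have hMlt : ∀ s x, Reach (M.Edge W) M.2.1 s x → s < k := by
    rintro s x (_ | ⟨-, ⟨e, he, -, rfl, -⟩⟩)
    · exact hM₀.trans_le (le_max_right _ _)
    · exact (hMk e he).2
  have hrep_zero : rep (num 0) = 0 := by
    ext i
    exact (hrep₀ 0 i).2 rfl
  refine ⟨C, ?_⟩
  constructor
  case start_lt => exact hnum_lt 0
  case next_start =>
    change C.next (num 0) 0 = num 0
    rw [hnext _ (hnum_lt 0) 0 zero_le, hrep_zero]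
    simp
  case coord_start =>
    intro i
    change C.coord (num 0) i = 0
    rw [hcoord _ (hnum_lt 0), hrep_zero]
    rfl
  case next_lt =>
    intro r hlt b hb
    rw [hnext r hlt b hb]
    exact hnum_lt _
  case coord_next =>
    intro r hlt b hb i
    rw [hnext r hlt b hb, hcoord _ (hnum_lt _), hcoord r hlt, hrep₀]
    simp
  case near_next =>
    intro r hlt b hb u hu
    have hu' : (fun i => (b i + u i) / 2) ≤ 2 := fun i => by
      have h₁ : u i ≤ 2 := hu i
      have h₂ : b i ≤ 1 := hb i
      simp only [Pi.ofNat_apply]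
      omega
    rw [hnext r hlt b hb, hnear _ (hnum_lt _) u hu, hnear r hlt _ hu',
      hnextColour _ _ (mod_two_le_one fun i => b i + u i), hcol _ _ (hrepu _ u hu)]
    congr 1
    ext i
    simp only [Pi.add_apply, Pi.smul_apply, smul_eq_mul]
    omega
  case init_lt => exact hN₀.trans_le (le_max_left _ _)
  case inFst_init =>
    change C.InFst (C.near (num 0) 0) _
    rw [hnear _ (hnum_lt 0) 0 zero_le, hrep_zero, hfst _ _ (hNlt _ _ .refl), add_zero]
    exact .refl
  case edge_lt => exact fun e he => (hNk e he).2
  case inFst_edge =>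
    intro r hlt e he
    rw [hnear r hlt 0 zero_le, hnear r hlt _ (hW e), hfst _ _ (hNk e he).1, hfst _ _ (hNk e he).2,
      add_zero]
    exact fun hs => hs.step ⟨e, he, rfl, rfl, rfl⟩
  case cover =>
    intro r hlt s hs
    rw [hnear r hlt 0 zero_le, hfst _ _ hs, add_zero]
    intro hx
    obtain ⟨t, ht⟩ := h s _ hx
    exact ⟨t, hMlt _ _ ht, (hsnd _ _ (hMlt _ _ ht)).2 ht⟩
  case inSnd =>
    intro r hlt u hu hru t ht
    simp only [hcoord r hlt] at hru ⊢
    rw [hnear r hlt u hu, hsnd _ _ ht]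
    intro hx
    generalize hy : rep r + u = y at hx
    rcases hx with _ | @⟨s, _, x, _, hs, e, he, rfl, rfl, rfl⟩
    · left
      refine ⟨rfl, fun i => ?_⟩
      have := congrFun hy i
      simp only [Pi.add_apply, Pi.zero_apply] at this
      omega
    · right
      have hle : ∀ i, W e i ≤ u i := by
        intro i
        have h₁ := congrFun hy i
        have h₂ : W e i ≤ 2 := hW e i
        have h₃ := hru i
        simp only [Pi.add_apply] at h₁
        omega
      have hx : rep r + (fun i => u i - W e i) = x := by
        ext i
        have h₁ := congrFun hy i
        have h₂ := hle i
        simp only [Pi.add_apply] at h₁ ⊢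
        omega
      refine ⟨e, he, rfl, (hMk e he).1, hle, ?_⟩
      rw [hnear r hlt _ fun i => (Nat.sub_le _ _).trans (hu i), hsnd _ _ (hMk e he).1, hx]
      exact hs

end Certificate
end MultiPort

/-! ### Primitive recursive Boolean functions -/

section Primrec

-- The closure properties are stated so that `fun_prop` can establish primitive recursiveness.
attribute [fun_prop] Primrec
attribute [fun_prop] Primrec.id Primrec.const Primrec.comp Primrec.pair

variable {α β γ : Type*} [Primcodable α] [Primcodable β] [Primcodable γ]

namespace PrimrecComp

theorem fst {f : α → β × γ} (hf : Primrec f) : Primrec fun a => (f a).1 := Primrec.fst.comp hf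

theorem snd {f : α → β × γ} (hf : Primrec f) : Primrec fun a => (f a).2 := Primrec.snd.comp hf

theorem add {f g : α → ℕ} (hf : Primrec f) (hg : Primrec g) : Primrec fun a => f a + g a :=
  Primrec.nat_add.comp hf hg

theorem sub {f g : α → ℕ} (hf : Primrec f) (hg : Primrec g) : Primrec fun a => f a - g a :=
  Primrec.nat_sub.comp hf hg

theorem div {f g : α → ℕ} (hf : Primrec f) (hg : Primrec g) : Primrec fun a => f a / g a :=
  Primrec.nat_div.comp hf hg

theorem mod {f g : α → ℕ} (hf : Primrec f) (hg : Primrec g) : Primrec fun a => f a % g a :=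
  Primrec.nat_mod.comp hf hg

theorem min {f g : α → ℕ} (hf : Primrec f) (hg : Primrec g) : Primrec fun a => min (f a) (g a) :=
  Primrec.nat_min.comp hf hg

theorem decide_lt {f g : α → ℕ} (hf : Primrec f) (hg : Primrec g) :
    Primrec fun a => decide (f a < g a) :=
  (PrimrecRel.decide Primrec.nat_lt).comp hf hg

theorem decide_le {f g : α → ℕ} (hf : Primrec f) (hg : Primrec g) :
    Primrec fun a => decide (f a ≤ g a) :=
  (PrimrecRel.decide Primrec.nat_le).comp hf hg

theorem decide_eq [DecidableEq β] {f g : α → β} (hf : Primrec f) (hg : Primrec g) :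
    Primrec fun a => decide (f a = g a) :=
  (PrimrecRel.decide Primrec.eq).comp hf hg

theorem and {f g : α → Bool} (hf : Primrec f) (hg : Primrec g) : Primrec fun a => f a && g a :=
  Primrec.and.comp hf hg

theorem or {f g : α → Bool} (hf : Primrec f) (hg : Primrec g) : Primrec fun a => f a || g a :=
  Primrec.or.comp hf hg

theorem not {f : α → Bool} (hf : Primrec f) : Primrec fun a => !f a := Primrec.not.comp hf

theorem toNat {f : α → Bool} (hf : Primrec f) : Primrec fun a => (f a).toNat :=
  (Primrec.dom_bool Bool.toNat).comp hf

theorem isSome {f : α → Option β} (hf : Primrec f) : Primrec fun a => (f a).isSome :=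
  Primrec.option_isSome.comp hf

theorem range {f : α → ℕ} (hf : Primrec f) : Primrec fun a => List.range (f a) :=
  Primrec.list_range.comp hf

theorem length {f : α → List β} (hf : Primrec f) : Primrec fun a => (f a).length :=
  Primrec.list_length.comp hf

theorem getD (d : β) {f : α → List β} {g : α → ℕ} (hf : Primrec f) (hg : Primrec g) :
    Primrec fun a => (f a).getD (g a) d :=
  (Primrec.list_getD d).comp hf hg

theorem cons {f : α → β} {g : α → List β} (hf : Primrec f) (hg : Primrec g) :
    Primrec fun a => f a :: g a :=
  Primrec.list_cons.comp hf hg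

theorem map {f : α → List β} {g : α → β → γ} (hf : Primrec f)
    (hg : Primrec fun z : α × β => g z.1 z.2) : Primrec fun a => (f a).map (g a) :=
  Primrec.list_map hf hg

theorem flatMap {f : α → List β} {g : α → β → List γ} (hf : Primrec f)
    (hg : Primrec fun z : α × β => g z.1 z.2) : Primrec fun a => (f a).flatMap (g a) :=
  Primrec.list_flatMap hf hg

theorem any {f : α → List β} {g : α → β → Bool} (hf : Primrec f)
    (hg : Primrec fun z : α × β => g z.1 z.2) : Primrec fun a => (f a).any (g a) :=
  (Primrec.list_foldr (h := fun a z => g a z.1 || z.2) hf (Primrec.const false)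
    (Primrec.or.comp (hg.comp (Primrec.pair Primrec.fst (Primrec.fst.comp Primrec.snd)))
      (Primrec.snd.comp Primrec.snd))).of_eq fun a => by
    induction f a <;> simp [*]

theorem all {f : α → List β} {g : α → β → Bool} (hf : Primrec f)
    (hg : Primrec fun z : α × β => g z.1 z.2) : Primrec fun a => (f a).all (g a) :=
  (Primrec.not.comp (any (g := fun a b => !g a b) hf (Primrec.not.comp hg))).of_eq fun a => by
    simp [List.all_eq_not_any_not]

theorem sum {f : α → List ℕ} (hf : Primrec f) : Primrec fun a => (f a).sum :=
  (Primrec.list_foldr (h := fun _ z => z.1 + z.2) hf (Primrec.const 0)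
    (Primrec.nat_add.comp (Primrec.fst.comp Primrec.snd) (Primrec.snd.comp Primrec.snd))).of_eq
    fun a => by induction f a <;> simp [*]

theorem lookup {f : α → List ℕ} {g : α → β} (hf : Primrec f) (hg : Primrec g) :
    Primrec fun a => MultiPort.lookup (f a) (g a) :=
  (Primrec.list_getD 0).comp hf (Primrec.encode.comp hg)

end PrimrecComp

attribute [fun_prop] PrimrecComp.fst PrimrecComp.snd PrimrecComp.add PrimrecComp.sub
  PrimrecComp.div PrimrecComp.mod PrimrecComp.min PrimrecComp.decide_lt PrimrecComp.decide_le
  PrimrecComp.decide_eq PrimrecComp.and PrimrecComp.or PrimrecComp.not PrimrecComp.toNat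
  PrimrecComp.isSome PrimrecComp.range PrimrecComp.length
  PrimrecComp.getD PrimrecComp.cons PrimrecComp.map
  PrimrecComp.flatMap PrimrecComp.any PrimrecComp.all PrimrecComp.sum PrimrecComp.lookup

/-- A problem is decidable if its positive and its negative instances have certificates that can be
checked: an unbounded search finds a certificate of one of the two kinds. -/
theorem exists_computable_of_certificates {α β γ : Type}
    [Primcodable α] [Primcodable β] [Primcodable γ] {P : α → Prop}
    {p : α → β → Bool} {n : α → γ → Bool}
    (hp : Primrec fun z : α × β => p z.1 z.2) (hn : Primrec fun z : α × γ => n z.1 z.2)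
    (hP : ∀ a, P a ↔ ∃ b, p a b = true) (hN : ∀ a, ¬P a ↔ ∃ c, n a c = true) :
    ∃ f : α → Bool, Computable f ∧ ∀ a, f a = true ↔ P a := by
  -- Certificates are encoded by natural numbers, so that one search can run through both kinds.
  have aux : ∀ {δ : Type} [Primcodable δ] {q : α → δ → Bool},
      Primrec (fun z : α × δ => q z.1 z.2) →
      Primrec fun z : α × ℕ => (((Encodable.decode z.2 : Option δ).map (q z.1)).getD false) := by
    intro δ _ q hq
    refine Primrec.option_getD.comp (Primrec.option_map (Primrec.decode.comp Primrec.snd) ?_)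
      (Primrec.const false)
    exact hq.comp (Primrec.pair (Primrec.fst.comp Primrec.fst) Primrec.snd)
  let p' : α → ℕ → Bool := fun a k => ((Encodable.decode k : Option β).map (p a)).getD false
  let n' : α → ℕ → Bool := fun a k => ((Encodable.decode k : Option γ).map (n a)).getD false
  have hp' : Primrec fun z : α × ℕ => p' z.1 z.2 := aux hp
  have hn' : Primrec fun z : α × ℕ => n' z.1 z.2 := aux hn
  have hP' : ∀ a, P a ↔ ∃ k, p' a k = true := by
    intro a
    rw [hP]
    constructor
    · rintro ⟨b, hb⟩; exact ⟨Encodable.encode b, by simpa [p'] using hb⟩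
    · rintro ⟨k, hk⟩
      cases h : (Encodable.decode k : Option β) with
      | none => simp [p', h] at hk
      | some b => exact ⟨b, by simpa [p', h] using hk⟩
  have hN' : ∀ a, ¬P a ↔ ∃ k, n' a k = true := by
    intro a
    rw [hN]
    constructor
    · rintro ⟨b, hb⟩; exact ⟨Encodable.encode b, by simpa [n'] using hb⟩
    · rintro ⟨k, hk⟩
      cases h : (Encodable.decode k : Option γ) with
      | none => simp [n', h] at hk
      | some b => exact ⟨b, by simpa [n', h] using hk⟩
  have hex : ∀ a, ∃ k, (p' a k || n' a k) = true := by
    intro a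
    by_cases h : P a
    · obtain ⟨k, hk⟩ := (hP' a).1 h; exact ⟨k, by simp [hk]⟩
    · obtain ⟨k, hk⟩ := (hN' a).1 h; exact ⟨k, by simp [hk]⟩
  have hfind : Computable fun a => Nat.find (hex a) :=
    Computable.find (P := fun a k => (p' a k || n' a k) = true)
      ((Primrec.or.comp hp' hn').of_eq fun _ => by simp).to_comp.computablePred hex
  refine ⟨fun a => p' a (Nat.find (hex a)), hp'.to_comp.comp (Computable.id.pair hfind),
    fun a => ?_⟩
  refine ⟨fun h => (hP' a).2 ⟨_, h⟩, fun h => ?_⟩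
  have := Nat.find_spec (hex a)
  rw [Bool.or_eq_true] at this
  exact this.resolve_right fun h' => (hN' a).2 ⟨_, h'⟩ h

end Primrec

namespace MultiPort

/-! ### The decision procedure on descriptions -/

/-- The coordinates of the weight of a transition between machines with `n` ports: the number of
observations at each port. The additional coordinate `n` counts the inputs whose port does not
exist, so that each transition of a malformed description has a nonzero weight as well. -/
def TransitionCode.weightAt (n : ℕ) (e : TransitionCode) (i : ℕ) : ℕ :=
  (decide (min e.1.2.1 n = i)).toNat + (e.2.2.getD i none).isSome.toNat

/-- The weight of a transition, as a vector. -/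
def TransitionCode.weight (n : ℕ) (e : TransitionCode) (i : Fin (n + 1)) : ℕ := e.weightAt n i

theorem TransitionCode.weight_le_two (n : ℕ) (e : TransitionCode) : e.weight n ≤ 2 := fun _ =>
  add_le_add (Bool.toNat_le _) (Bool.toNat_le _)

theorem TransitionCode.weight_ne_zero (n : ℕ) (e : TransitionCode) : e.weight n ≠ 0 := by
  intro h
  have := congrFun h ⟨min e.1.2.1 n, by omega⟩
  simp [weight, weightAt] at this

/-- The vectors of length `d` with entries at most `B`, as lists. -/
def vectors (B d : ℕ) : List (List ℕ) :=
  d.rec [[]] fun _ L => L.flatMap fun l => (List.range (B + 1)).map fun j => j :: l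

theorem mem_vectors {B d : ℕ} {l : List ℕ} :
    l ∈ vectors B d ↔ ∃ u : Fin d → ℕ, (∀ i, u i ≤ B) ∧ List.ofFn u = l := by
  induction d generalizing l with
  | zero => simp [vectors, eq_comm]
  | succ d ih =>
    change l ∈ (vectors B d).flatMap _ ↔ _
    simp only [List.mem_flatMap, ih, List.mem_map, List.mem_range]
    constructor
    · rintro ⟨_, ⟨u, hu, rfl⟩, j, hj, rfl⟩
      exact ⟨Fin.cons j u, Fin.cases (Nat.le_of_lt_succ hj) hu, by simp [List.ofFn_succ]⟩
    · rintro ⟨u, hu, rfl⟩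
      exact ⟨_, ⟨fun i => u i.succ, fun i => hu _, rfl⟩, u 0, Nat.lt_succ_of_le (hu 0), by
        simp [List.ofFn_succ]⟩

theorem map_range_eq_ofFn {β : Type*} (d : ℕ) (f : ℕ → β) :
    (List.range d).map f = List.ofFn fun i : Fin d => f i := by
  apply List.ext_getElem <;> simp

theorem getD_ofFn {d : ℕ} (u : Fin d → ℕ) (i : Fin d) : (List.ofFn u).getD i 0 = u i := by
  simp

@[fun_prop]
theorem primrec_weightAt {α : Type*} [Primcodable α] {n i : α → ℕ} {e : α → TransitionCode}
    (hn : Primrec n) (he : Primrec e) (hi : Primrec i) :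
    Primrec fun a => (e a).weightAt (n a) (i a) := by
  unfold TransitionCode.weightAt
  fun_prop

@[fun_prop]
theorem primrec_vectors {α : Type*} [Primcodable α] {B d : α → ℕ} (hB : Primrec B)
    (hd : Primrec d) : Primrec fun a => vectors (B a) (d a) := by
  refine Primrec.nat_rec' (h := fun a z => z.2.flatMap fun l =>
    (List.range (B a + 1)).map fun j => j :: l) hd (Primrec.const [[]]) ?_
  unfold Primrec₂
  fun_prop

/-- The ends and the weights of the walks of `j` edges from the initial vertex. The list of length
`0` or `1` over which the innermost `map` runs selects the edges that continue the given walk. -/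
def FSMCode.walks (n : ℕ) (c : FSMCode) (j : ℕ) : List (ℕ × List ℕ) :=
  j.rec [(c.2.1, (List.range (n + 1)).map fun _ => 0)] fun _ L => L.flatMap fun a =>
    c.2.2.flatMap fun e => (List.range (decide (e.1.1 = a.1)).toNat).map fun _ =>
      (e.2.1, (List.range (n + 1)).map fun i => a.2.getD i 0 + e.weightAt n i)

@[fun_prop]
theorem primrec_walks {α : Type*} [Primcodable α] {n j : α → ℕ} {c : α → FSMCode}
    (hn : Primrec n) (hc : Primrec c) (hj : Primrec j) :
    Primrec fun a => (c a).walks (n a) (j a) := by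
  refine Primrec.nat_rec' (g := fun a => [((c a).2.1, (List.range (n a + 1)).map fun _ => 0)])
    (h := fun a z => z.2.flatMap fun p => (c a).2.2.flatMap fun e =>
    (List.range (decide (e.1.1 = p.1)).toNat).map fun _ =>
      (e.2.1, (List.range (n a + 1)).map fun i => p.2.getD i 0 + e.weightAt (n a) i)) hj ?_ ?_
  · fun_prop
  · unfold Primrec₂
    fun_prop

theorem FSMCode.mem_walks_succ {n j : ℕ} {c : FSMCode} {a : ℕ × List ℕ} :
    a ∈ c.walks n (j + 1) ↔ ∃ b ∈ c.walks n j, ∃ e ∈ c.2.2, e.1.1 = b.1 ∧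
      a = (e.2.1, (List.range (n + 1)).map fun i => b.2.getD i 0 + e.weightAt n i) := by
  change a ∈ (c.walks n j).flatMap _ ↔ _
  rw [List.mem_flatMap]
  refine exists_congr fun b => and_congr_right fun _ => ?_
  rw [List.mem_flatMap]
  refine exists_congr fun e => and_congr_right fun _ => ?_
  rw [List.mem_map]
  simp only [List.mem_range]
  constructor
  · rintro ⟨k, hk, rfl⟩
    refine ⟨?_, rfl⟩
    by_contra h
    rw [decide_eq_false h] at hk
    exact Nat.not_lt_zero _ hk
  · rintro ⟨h, rfl⟩
    exact ⟨0, by simp [h], rfl⟩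

theorem FSMCode.reach_of_mem_walks {n j : ℕ} {c : FSMCode} {a : ℕ × List ℕ}
    (h : a ∈ c.walks n j) : ∃ x : Fin (n + 1) → ℕ, List.ofFn x = a.2 ∧
      Reach (c.Edge (TransitionCode.weight n)) c.2.1 a.1 x := by
  induction j generalizing a with
  | zero =>
    obtain rfl : a = (c.2.1, (List.range (n + 1)).map fun _ => 0) := List.mem_singleton.1 h
    exact ⟨0, (map_range_eq_ofFn (n + 1) fun _ => 0).symm, .refl⟩
  | succ j ih =>
    obtain ⟨⟨s, l⟩, hb, e, he, rfl, rfl⟩ := mem_walks_succ.1 h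
    obtain ⟨x, hx, hs⟩ := ih hb
    refine ⟨x + e.weight n, ?_, hs.step ⟨e, he, rfl, rfl, rfl⟩⟩
    dsimp only at hx
    rw [map_range_eq_ofFn, ← hx]
    congr 1
    ext i
    rw [getD_ofFn]; rfl

/-- As no transition has weight `0`, the length of a walk is bounded in terms of its weight. -/
theorem FSMCode.mem_walks_of_reach {n s : ℕ} {c : FSMCode} {x : Fin (n + 1) → ℕ}
    (h : Reach (c.Edge (TransitionCode.weight n)) c.2.1 s x) :
    ∃ j ≤ ∑ i, x i, (s, List.ofFn x) ∈ c.walks n j := by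
  induction h with
  | refl => exact ⟨0, Nat.zero_le _, by
      rw [show List.ofFn (0 : Fin (n + 1) → ℕ) = _ from (map_range_eq_ofFn (n + 1) fun _ => 0).symm]
      exact List.mem_singleton.2 rfl⟩
  | @step s t x v _ he ih =>
    obtain ⟨e, he, rfl, rfl, rfl⟩ := he
    obtain ⟨j, hj, hmem⟩ := ih
    refine ⟨j + 1, ?_, mem_walks_succ.2 ⟨_, hmem, e, he, rfl, ?_⟩⟩
    · obtain ⟨i, hi⟩ := Function.ne_iff.1 (e.weight_ne_zero n)
      have := Finset.single_le_sum (f := e.weight n) (fun i _ => Nat.zero_le _) (Finset.mem_univ i)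
      simp only [Pi.add_apply, Finset.sum_add_distrib]
      simp only [Pi.zero_apply] at hi
      omega
    · rw [map_range_eq_ofFn]
      congr 2
      ext i
      rw [getD_ofFn]; rfl

/-- Some walk of `j` edges in `N` has a weight that no walk in `M` has. -/
def refutes (n : ℕ) (N M : FSMCode) (j : ℕ) : Bool :=
  (N.walks n j).any fun a => (List.range (a.2.sum + 1)).all fun i =>
    (M.walks n i).all fun b => !decide (b.2 = a.2)

theorem exists_refutes_iff (n : ℕ) (N M : FSMCode) : (∃ j, refutes n N M j = true) ↔
    ¬ ∀ s x, Reach (N.Edge (TransitionCode.weight n)) N.2.1 s x →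
      ∃ t, Reach (M.Edge (TransitionCode.weight n)) M.2.1 t x := by
  push Not
  simp only [refutes, List.any_eq_true, List.all_eq_true, List.mem_range, Bool.not_eq_true',
    decide_eq_false_iff_not]
  constructor
  · rintro ⟨j, ⟨s, l⟩, ha, hM⟩
    obtain ⟨x, rfl, hx⟩ := FSMCode.reach_of_mem_walks ha
    refine ⟨s, x, hx, fun t ht => ?_⟩
    obtain ⟨i, hi, hmem⟩ := FSMCode.mem_walks_of_reach ht
    refine hM i ?_ _ hmem rfl
    rw [List.sum_ofFn]
    omega
  · rintro ⟨s, x, hx, hM⟩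
    obtain ⟨j, -, hmem⟩ := FSMCode.mem_walks_of_reach hx
    refine ⟨j, _, hmem, fun i _ b hb h => ?_⟩
    obtain ⟨y, hy, ht⟩ := FSMCode.reach_of_mem_walks hb
    obtain rfl : y = x := List.ofFn_injective (hy.trans h)
    exact hM _ ht

theorem primrec_refutes : Primrec fun z : (InterfaceCode × FSMCode × FSMCode) × ℕ =>
    refutes z.1.1.length z.1.2.1 z.1.2.2 z.2 := by
  unfold refutes
  fun_prop

namespace Certificate

/-- The null vector of length `d`, as a list. -/
def nullVector (d : ℕ) : List ℕ := (List.range d).map fun _ => 0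

theorem nullVector_eq (d : ℕ) : nullVector d = List.ofFn (0 : Fin d → ℕ) :=
  map_range_eq_ofFn d fun _ => 0

@[fun_prop]
theorem primrec_nullVector {α : Type*} [Primcodable α] {d : α → ℕ} (hd : Primrec d) :
    Primrec fun a => nullVector (d a) := by
  unfold nullVector
  fun_prop

/-- The conditions of `Valid` on the automaton. -/
def checkAutomaton (d : ℕ) (C : Certificate) : Bool :=
  decide (C.start < C.card) && decide (lookup C.2.1.1 (C.start, nullVector d) = C.start) &&
  ((List.range d).all fun i => decide (lookup C.2.2.1 (C.start, i) = 0)) &&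
  (List.range C.card).all fun r => (vectors 1 d).all fun b =>
    decide (lookup C.2.1.1 (r, b) < C.card) &&
    ((List.range d).all fun i =>
      decide (decide (lookup C.2.2.1 (lookup C.2.1.1 (r, b), i) = 0) =
        (decide (lookup C.2.2.1 (r, i) = 0) && decide (b.getD i 0 = 0)))) &&
    (vectors 2 d).all fun u => decide (lookup C.2.1.2.1 (lookup C.2.1.1 (r, b), u) =
      lookup C.2.1.2.2 (lookup C.2.1.2.1 (r, (List.range d).map fun i =>
        (b.getD i 0 + u.getD i 0) / 2), (List.range d).map fun i =>
        (b.getD i 0 + u.getD i 0) % 2))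

/-- The conditions of `Valid` on the sets assigned to the vertices of the first graph. -/
def checkFst (n : ℕ) (N : FSMCode) (C : Certificate) : Bool :=
  decide (N.2.1 < C.bound) &&
  decide (lookup C.2.2.2.1 (lookup C.2.1.2.1 (C.start, nullVector (n + 1)), N.2.1) = 1) &&
  (N.2.2.all fun e => decide (e.2.1 < C.bound)) &&
  ((List.range C.card).all fun r => N.2.2.all fun e =>
    !decide (lookup C.2.2.2.1 (lookup C.2.1.2.1 (r, nullVector (n + 1)), e.1.1) = 1) ||
    decide (lookup C.2.2.2.1 (lookup C.2.1.2.1 (r, (List.range (n + 1)).map fun i =>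
      e.weightAt n i), e.2.1) = 1)) &&
  (List.range C.card).all fun r => (List.range C.bound).all fun s =>
    !decide (lookup C.2.2.2.1 (lookup C.2.1.2.1 (r, nullVector (n + 1)), s) = 1) ||
    (List.range C.bound).any fun t =>
      decide (lookup C.2.2.2.2 (lookup C.2.1.2.1 (r, nullVector (n + 1)), t) = 1)

/-- The alternatives in the condition `inSnd` of `Valid`, for a vertex `t` and a vector of digits
`u` added in state `r`: either the sum is null and `t` is the initial vertex, or an edge of `M` to
`t` can be removed. -/
def checkOrigin (n : ℕ) (M : FSMCode) (C : Certificate) (r : ℕ) (u : List ℕ) (t : ℕ) : Bool :=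
  (decide (t = M.2.1) && (List.range (n + 1)).all fun i =>
      decide (lookup C.2.2.1 (r, i) = 0) && decide (u.getD i 0 = 0)) ||
    M.2.2.any fun e => decide (e.2.1 = t) && (decide (e.1.1 < C.bound) &&
      (((List.range (n + 1)).all fun i => decide (e.weightAt n i ≤ u.getD i 0)) &&
        decide (lookup C.2.2.2.2 (lookup C.2.1.2.1 (r, (List.range (n + 1)).map fun i =>
          u.getD i 0 - e.weightAt n i), e.1.1) = 1)))

/-- The condition of `Valid` on the sets assigned to the vertices of the second graph. -/
def checkSnd (n : ℕ) (M : FSMCode) (C : Certificate) : Bool :=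
  (List.range C.card).all fun r => (vectors 2 (n + 1)).all fun u =>
    !((List.range (n + 1)).all fun i =>
      decide (lookup C.2.2.1 (r, i) = 0) || decide (u.getD i 0 = 2)) ||
    (List.range C.bound).all fun t =>
      !decide (lookup C.2.2.2.2 (lookup C.2.1.2.1 (r, u), t) = 1) || checkOrigin n M C r u t

/-- A test of the validity of a certificate. -/
def check (n : ℕ) (N M : FSMCode) (C : Certificate) : Bool :=
  checkAutomaton (n + 1) C && checkFst n N C && checkSnd n M C

theorem all_range_iff {d : ℕ} {p : ℕ → Bool} :
    (List.range d).all p = true ↔ ∀ i : Fin d, p i = true := by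
  simp [Fin.forall_iff]

theorem forall_mem_vectors_iff {B d : ℕ} {P : List ℕ → Prop} :
    (∀ l ∈ vectors B d, P l) ↔ ∀ u : Fin d → ℕ, (∀ i, u i ≤ B) → P (List.ofFn u) := by
  simp only [mem_vectors]
  exact ⟨fun h u hu => h _ ⟨u, hu, rfl⟩, by rintro h _ ⟨u, hu, rfl⟩; exact h u hu⟩

theorem checkAutomaton_iff {d : ℕ} {C : Certificate} : checkAutomaton d C = true ↔
    C.start < C.card ∧ C.next C.start (0 : Fin d → ℕ) = C.start ∧
    (∀ i : Fin d, C.coord C.start i = 0) ∧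
    ∀ r < C.card, ∀ b : Fin d → ℕ, b ≤ 1 → C.next r b < C.card ∧
      (∀ i : Fin d, C.coord (C.next r b) i = 0 ↔ C.coord r i = 0 ∧ b i = 0) ∧
      ∀ u : Fin d → ℕ, u ≤ 2 → C.near (C.next r b) u =
        C.nextColour (C.near r fun i => (b i + u i) / 2) fun i => (b i + u i) % 2 := by
  simp only [checkAutomaton, Bool.and_eq_true, decide_eq_true_eq, forall_mem_vectors_iff,
    all_range_iff (d := d), nullVector_eq, map_range_eq_ofFn, getD_ofFn, List.all_eq_true,
    List.mem_range, and_assoc, next, near, nextColour, coord,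
    Pi.le_def, Pi.ofNat_apply, ← Bool.decide_and, decide_eq_decide]

theorem checkFst_iff {n : ℕ} {N : FSMCode} {C : Certificate} : checkFst n N C = true ↔
    N.2.1 < C.bound ∧ C.InFst (C.near C.start (0 : Fin (n + 1) → ℕ)) N.2.1 ∧
    (∀ e ∈ N.2.2, e.2.1 < C.bound) ∧
    (∀ r < C.card, ∀ e ∈ N.2.2, C.InFst (C.near r (0 : Fin (n + 1) → ℕ)) e.1.1 →
      C.InFst (C.near r (e.weight n)) e.2.1) ∧
    ∀ r < C.card, ∀ s < C.bound, C.InFst (C.near r (0 : Fin (n + 1) → ℕ)) s →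
      ∃ t < C.bound, C.InSnd (C.near r (0 : Fin (n + 1) → ℕ)) t := by
  simp only [checkFst, Bool.and_eq_true, Bool.or_eq_true, Bool.not_eq_true', decide_eq_true_eq,
    decide_eq_false_iff_not, ← imp_iff_not_or, nullVector_eq, map_range_eq_ofFn, List.all_eq_true,
    List.any_eq_true, List.mem_range, and_assoc, near, InFst, InSnd]
  rfl

theorem checkSnd_iff {n : ℕ} {M : FSMCode} {C : Certificate} : checkSnd n M C = true ↔
    ∀ r < C.card, ∀ u : Fin (n + 1) → ℕ, u ≤ 2 →
      (∀ i : Fin (n + 1), C.coord r i = 0 ∨ u i = 2) →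
      ∀ t < C.bound, C.InSnd (C.near r u) t →
      (t = M.2.1 ∧ ∀ i : Fin (n + 1), C.coord r i = 0 ∧ u i = 0) ∨
      ∃ e ∈ M.2.2, e.2.1 = t ∧ e.1.1 < C.bound ∧ (∀ i : Fin (n + 1), e.weight n i ≤ u i) ∧
        C.InSnd (C.near r fun i => u i - e.weight n i) e.1.1 := by
  simp only [checkSnd, checkOrigin, Bool.and_eq_true, Bool.or_eq_true, Bool.not_eq_true',
    decide_eq_true_eq, ← Bool.not_eq_true, ← imp_iff_not_or, forall_mem_vectors_iff,
    all_range_iff (d := n + 1), map_range_eq_ofFn, getD_ofFn, List.all_eq_true,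
    List.any_eq_true, List.mem_range, near, coord, InSnd]
  rfl

theorem check_iff {n : ℕ} {N M : FSMCode} {C : Certificate} :
    check n N M C = true ↔ C.Valid (TransitionCode.weight n) N M := by
  rw [check, Bool.and_eq_true, Bool.and_eq_true, checkAutomaton_iff, checkFst_iff, checkSnd_iff]
  constructor
  · rintro ⟨⟨⟨h₁, h₂, h₃, h₄⟩, h₅, h₆, h₇, h₈, h₉⟩, h₁₀⟩
    exact ⟨h₁, h₂, h₃, fun r hr b hb => (h₄ r hr b hb).1, fun r hr b hb => (h₄ r hr b hb).2.1,
      fun r hr b hb => (h₄ r hr b hb).2.2, h₅, h₆, h₇, h₈, h₉, h₁₀⟩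
  · rintro ⟨h₁, h₂, h₃, h₄, h₅, h₆, h₇, h₈, h₉, h₁₀, h₁₁, h₁₂⟩
    exact ⟨⟨⟨h₁, h₂, h₃, fun r hr b hb => ⟨h₄ r hr b hb, h₅ r hr b hb, h₆ r hr b hb⟩⟩,
      h₇, h₈, h₉, h₁₀, h₁₁⟩, h₁₂⟩

@[fun_prop]
theorem primrec_checkAutomaton {α : Type*} [Primcodable α] {d : α → ℕ} {C : α → Certificate}
    (hd : Primrec d) (hC : Primrec C) : Primrec fun a => checkAutomaton (d a) (C a) := by
  unfold checkAutomaton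
  fun_prop

@[fun_prop]
theorem primrec_checkFst {α : Type*} [Primcodable α] {n : α → ℕ} {N : α → FSMCode}
    {C : α → Certificate} (hn : Primrec n) (hN : Primrec N) (hC : Primrec C) :
    Primrec fun a => checkFst (n a) (N a) (C a) := by
  unfold checkFst
  fun_prop

@[fun_prop]
theorem primrec_checkOrigin {α : Type*} [Primcodable α] {n r t : α → ℕ} {M : α → FSMCode}
    {C : α → Certificate} {u : α → List ℕ} (hn : Primrec n) (hM : Primrec M) (hC : Primrec C)
    (hr : Primrec r) (hu : Primrec u) (ht : Primrec t) :
    Primrec fun a => checkOrigin (n a) (M a) (C a) (r a) (u a) (t a) := by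
  unfold checkOrigin
  fun_prop

@[fun_prop]
theorem primrec_checkSnd {α : Type*} [Primcodable α] {n : α → ℕ} {M : α → FSMCode}
    {C : α → Certificate} (hn : Primrec n) (hM : Primrec M) (hC : Primrec C) :
    Primrec fun a => checkSnd (n a) (M a) (C a) := by
  unfold checkSnd
  fun_prop

theorem primrec_check : Primrec fun z : (InterfaceCode × FSMCode × FSMCode) × Certificate =>
    check z.1.1.length z.1.2.1 z.1.2.2 z.2 := by
  unfold check
  fun_prop

end Certificate

/-- Inclusion of the sets of weights of walks is decidable: certificates show inclusion, and walks
show the contrary. -/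
theorem exists_computable_reach_subset :
    ∃ f : InterfaceCode × FSMCode × FSMCode → Bool, Computable f ∧ ∀ c, f c = true ↔
      ∀ s x, Reach (c.2.1.Edge (TransitionCode.weight c.1.length)) c.2.1.2.1 s x →
        ∃ t, Reach (c.2.2.Edge (TransitionCode.weight c.1.length)) c.2.2.2.1 t x := by
  refine exists_computable_of_certificates
    (p := fun c => Certificate.check c.1.length c.2.1 c.2.2)
    (n := fun c => refutes c.1.length c.2.1 c.2.2) Certificate.primrec_check primrec_refutes
    (fun c => ⟨fun h => ?_, ?_⟩) fun c => (exists_refutes_iff _ _ _).symm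
  · obtain ⟨C, hC⟩ := Certificate.exists_valid (TransitionCode.weight_le_two c.1.length) h
    exact ⟨C, Certificate.check_iff.2 hC⟩
  · rintro ⟨C, hC⟩ s x h
    exact (Certificate.check_iff.1 hC).sound (TransitionCode.weight_le_two _)
      (TransitionCode.weight_ne_zero _) h

/-! ### Machines and their descriptions -/

section Describes

variable {n : ℕ} {A : Type*} [DecidableEq A] {Γ : Interface n A}

/-- The number of observations at each port in a transition with a given label, with an additional
null coordinate as in the weights of described transitions. -/
def labelWeight (a : Γ.Input × Γ.Output) (i : Fin (n + 1)) : ℕ :=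
  if h : (i : ℕ) < n then (Γ.proj ⟨i, h⟩ [a]).length else 0

theorem sum_labelWeight (σ : Γ.Trace) (i : Fin (n + 1)) :
    (σ.map labelWeight).sum i = if h : (i : ℕ) < n then (Γ.proj ⟨i, h⟩ σ).length else 0 := by
  induction σ with
  | nil => simp [Interface.proj]
  | cons a σ ih =>
    obtain ⟨⟨q, x⟩, y⟩ := a
    rw [List.map_cons, List.sum_cons, Pi.add_apply, ih, labelWeight]
    split_ifs <;> simp [Interface.proj, add_assoc]

theorem indist_iff_sum_labelWeight (hΓ : ∀ p, (Γ.Act p).card ≤ 1) (σ σ' : Γ.Trace) :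
    Γ.Indist σ σ' ↔ (σ.map labelWeight).sum = (σ'.map labelWeight).sum := by
  rw [Γ.indist_iff_length hΓ]
  constructor
  · intro h
    ext i
    rw [sum_labelWeight, sum_labelWeight]
    split_ifs with hi
    · exact h _
    · rfl
  · intro h p
    have := congrFun h p.castSucc
    rw [sum_labelWeight, sum_labelWeight] at this
    simpa using this

theorem weight_eq_labelWeight (ν : A → ℕ) (s s' : ℕ) (x : Γ.Input) (y : Γ.Output) :
    TransitionCode.weight n ((s, (x.1 : ℕ), ν x.2), (s', List.ofFn fun p => (y p).map fun z => ν z))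
      = labelWeight (x, y) := by
  obtain ⟨q, x⟩ := x
  ext ⟨i, hi⟩
  have hq : min (q : ℕ) n = q := min_eq_left q.2.le
  simp only [TransitionCode.weight, TransitionCode.weightAt, labelWeight, Interface.proj, hq]
  by_cases h : i < n
  · have h₁ : (List.ofFn fun p => (y p).map fun z => ν z).getD i none =
        (y ⟨i, h⟩).map fun z => ν z := by
      simp [List.getD_eq_getElem?_getD, h]
    rw [h₁, dif_pos h]
    by_cases h₂ : (q : ℕ) = i
    · have h₃ : q = ⟨i, h⟩ := Fin.ext h₂
      cases y ⟨i, h⟩ <;> simp [h₃]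
    · cases y ⟨i, h⟩ <;> simp [h₂, Fin.ext_iff]
  · have h₁ : (List.ofFn fun p => (y p).map fun z => ν z).getD i none = none := by
      simp [List.getD_eq_getElem?_getD, h]
    have h₂ : (q : ℕ) ≠ i := fun h₂ => h (h₂ ▸ q.2)
    simp [h₂, h]

/-- The walks in the graph of a description are those in the graph of the machine. -/
theorem FSMCode.Describes.exists_reach_iff {ν : A → ℕ} {c : FSMCode} {M : FSM Γ}
    (h : c.Describes ν M) (x : Fin (n + 1) → ℕ) :
    (∃ t, Reach (c.Edge (TransitionCode.weight n)) c.2.1 t x) ↔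
      ∃ σ ∈ M.lang, (σ.map labelWeight).sum = x := by
  obtain ⟨e, hinit, he⟩ := h
  have hM : (∃ σ ∈ M.lang, (σ.map labelWeight).sum = x) ↔
      ∃ s, Reach (M.Edge labelWeight) M.init s x := by
    simp only [FSM.reach_edge_iff, FSM.lang]
    constructor
    · rintro ⟨σ, ⟨s, hs⟩, hσ⟩; exact ⟨s, σ, hs, hσ⟩
    · rintro ⟨s, σ, hs, hσ⟩; exact ⟨σ, ⟨s, hs⟩, hσ⟩
  rw [hM, hinit]
  clear hM
  constructor
  · rintro ⟨t, ht⟩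
    suffices ∃ s, (e s : ℕ) = t ∧ Reach (M.Edge labelWeight) M.init s x from
      this.imp fun _ => And.right
    induction ht with
    | refl => exact ⟨_, rfl, .refl⟩
    | step _ hedge ih =>
      obtain ⟨s, rfl, hs⟩ := ih
      obtain ⟨_, hmem, hsrc, rfl, rfl⟩ := hedge
      obtain ⟨s₁, a, s₂, y, hM, rfl⟩ := (he _).1 hmem
      obtain rfl : s₁ = s := e.injective (Fin.ext hsrc)
      rw [weight_eq_labelWeight]
      exact ⟨s₂, rfl, hs.step ⟨(a, y), hM, rfl⟩⟩
  · rintro ⟨s, hs⟩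
    refine ⟨e s, ?_⟩
    induction hs with
    | refl => exact .refl
    | step _ hedge ih =>
      obtain ⟨⟨a, y⟩, hM, rfl⟩ := hedge
      exact ih.step ⟨_, (he _).2 ⟨_, a, _, y, hM, rfl⟩, rfl, rfl, (weight_eq_labelWeight ..).symm⟩

theorem stronglyConforms_iff_of_describes (hΓ : ∀ p, (Γ.Act p).card ≤ 1) {N M : FSM Γ} {ν : A → ℕ}
    {cN cM : FSMCode} (hN : cN.Describes ν N) (hM : cM.Describes ν M) :
    N.StronglyConforms M ↔ ∀ s x, Reach (cN.Edge (TransitionCode.weight n)) cN.2.1 s x →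
      ∃ t, Reach (cM.Edge (TransitionCode.weight n)) cM.2.1 t x := by
  simp only [FSM.StronglyConforms, indist_iff_sum_labelWeight hΓ]
  constructor
  · intro h s x hs
    obtain ⟨σ, hσ, rfl⟩ := (hN.exists_reach_iff x).1 ⟨s, hs⟩
    exact (hM.exists_reach_iff _).2 (h σ hσ)
  · intro h σ hσ
    obtain ⟨s, hs⟩ := (hN.exists_reach_iff _).2 ⟨σ, hσ, rfl⟩
    exact (hM.exists_reach_iff _).1 (h s _ hs)

end Describes

end MultiPort

theorem mainTheorem10 :
    (∀ (n : ℕ) (A : Type*) [DecidableEq A] (Γ : MultiPort.Interface n A),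
      (∀ p, (Γ.Act p).card ≤ 1) →
      ∀ N M : MultiPort.FSM Γ,
        IsSemilinearSet (Γ.parikhImage N.lang) ∧
        IsSemilinearSet (Γ.parikhImage M.lang) ∧
        (N.StronglyConforms M ↔ Γ.parikhImage N.lang ⊆ Γ.parikhImage M.lang)) ∧
    (∃ f : MultiPort.InterfaceCode × MultiPort.FSMCode × MultiPort.FSMCode → Bool,
      Computable f ∧
      ∀ (n : ℕ) (A : Type*) [DecidableEq A] (Γ : MultiPort.Interface n A),
        (∀ p, (Γ.Act p).card ≤ 1) →
        ∀ (N M : MultiPort.FSM Γ) (ν : A → ℕ)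
          (cΓ : MultiPort.InterfaceCode) (cN cM : MultiPort.FSMCode),
          MultiPort.IsNaming Γ ν → cΓ.Describes ν Γ → cN.Describes ν N → cM.Describes ν M →
          (f (cΓ, cN, cM) = true ↔ N.StronglyConforms M)) := by
  refine ⟨fun n A _ Γ hΓ N M => ⟨MultiPort.isSemilinearSet_parikhImage_lang N,
    MultiPort.isSemilinearSet_parikhImage_lang M,
    MultiPort.stronglyConforms_iff_parikhImage_subset hΓ N M⟩, ?_⟩
  obtain ⟨f, hf, h⟩ := MultiPort.exists_computable_reach_subset
  refine ⟨f, hf, fun n A _ Γ hΓ N M ν cΓ cN cM _ hcΓ hN hM => ?_⟩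
  obtain rfl : cΓ.length = n := by simpa using congrArg List.length hcΓ
  rw [h, MultiPort.stronglyConforms_iff_of_describes hΓ hN hM]
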